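/- Let $\mathbb{k}$ be a field of characteristic zero. A (right) Leibniz algebra is a $\mathbb{k}$-vector space $\mathfrak{g}$ with a bilinear product such that $x(yz)=(xy)z-(xz)y$. Let $s\mathfrak{g}$ be $\mathfrak{g}$ placed in homological degree $1$, and let $T(s\mathfrak{g})$ be the tensor algebra, with $T^n(s\mathfrak{g})$ in degree $n$; it is a graded Hopf algebra (with Koszul signs) in which the elements of $s\mathfrak{g}$ are primitive. The Leibniz complex is $(T(s\mathfrak{g}),d)$ with the differential $d$ of degree $-1$ given by $$d(sx_1\otimes\cdots\otimes sx_n)=\sum_{1\le i<j\le n}(-1)^{j+1}\, sx_1\otimes\cdots\otimes s(x_ix_j)\otimes\cdots\otimes\widehat{sx_j}\otimes\cdots\otimes sx_n .$$ Let $\mathsf{Lie}(s\mathfrak{g})\subset T(s\mathfrak{g})$ be the free graded Lie algebra on $s\mathfrak{g}$, realised as the graded Lie subalgebra generated by $s\mathfrak{g}$ under the graded commutator; it is the space of primitive elements of $T(s\mathfrak{g})$. For $n\in\mathbb{N}$ let $\mathsf{f}_nT(s\mathfrak{g})$ be the image of $\bigoplus_{i\le n}\mathsf{Lie}(s\mathfrak{g})^{\otimes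 i}$ under the multiplication of $T(s\mathfrak{g})$, and let $\mathsf{f}_{-1}T(s\mathfrak{g})=0$. For a complex $(W,d_W)$, let $S^n(W,d_W)$ be the complex of coinvariants of $(W,d_W)^{\otimes n}$ under the symmetric group $\mathfrak{S}_n$, acting by place permutations with Koszul signs. Then for every Leibniz algebra $\mathfrak{g}$, $d^2=0$, and $\mathsf{Lie}(s\mathfrak{g})$ and, for every $n\in\mathbb{N}$, $\mathsf{f}_nT(s\mathfrak{g})$ are subcomplexes (graded subspaces stable under $d$) of the Leibniz complex $(T(s\mathfrak{g}),d)$. This defines an increasing, exhaustive filtration $$\mathsf{f}_0T(s\mathfrak{g})=\mathbb{k}\subset\cdots\subset\mathsf{f}_nT(s\mathfrak{g})\subset\mathsf{f}_{n+1}T(s\mathfrak{g})\subset\cdots\subset T(s\mathfrak{g}).$$ Moreover, for every $n\in\mathbb{N}$ there is an isomorphism of complexes, natural in the Leibniz algebra $\mathfrak{g}$, $$S^n(\mathsf{Lie}(s\mathfrak{g}),d)\;\cong\;\mathsf{f}_nT(s\mathfrak{g})/\mathsf{f}_{n-1}T(s\mathfrak{g}),$$ which sends the class of $X_1\otimes\cdots\otimes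 X_n$ to the class of the product $X_1\cdots X_n$. -/

import Mathlib

open scoped TensorProduct DirectSum

universe u v

noncomputable section

/-! ### Graded symmetric powers of a graded module with a differential -/

namespace GradedSym

variable {k : Type*} [Field k] {W : Type*} [AddCommGroup W] [Module k W]

/-- The sign involution `w ↦ (-1)^|w| w` of a graded vector space. -/
def parity (𝒲 : ℕ → Submodule k W) [DirectSum.Decomposition 𝒲] : W →ₗ[k] W :=
  (DirectSum.toModule k ℕ W fun m => ((-1 : k) ^ m) • (𝒲 m).subtype) ∘ₗ
    (DirectSum.decomposeLinearEquiv 𝒲).toLinearMap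

theorem parity_of_mem (𝒲 : ℕ → Submodule k W) [DirectSum.Decomposition 𝒲] {m : ℕ} {w : W}
    (hw : w ∈ 𝒲 m) : parity 𝒲 w = ((-1 : k) ^ m) • w := by
  lift w to 𝒲 m using hw
  simp [parity]

/-- The Koszul sign of the rearrangement `w₀ ⊗ ⋯ ⊗ wₙ₋₁ ↦ w_{σ 0} ⊗ ⋯ ⊗ w_{σ (n-1)}`, where the
factor `wᵢ` has degree `p i`: each pair that changes its order contributes the sign
`(-1)^(product of the two degrees)`. -/
def koszulSign {n : ℕ} (σ : Equiv.Perm (Fin n)) (p : Fin n → ℕ) : k :=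
  ∏ a : Fin n, ∏ b : Fin n, if a < b ∧ σ b < σ a then (-1 : k) ^ (p (σ a) * p (σ b)) else 1

/-- The span of all differences `t - t·σ` in `W^{⊗ n}`, where the symmetric group permutes the
factors with Koszul signs. -/
def symRel (𝒲 : ℕ → Submodule k W) (n : ℕ) : Submodule k (⨂[k]^n W) :=
  Submodule.span k {t | ∃ (σ : Equiv.Perm (Fin n)) (p : Fin n → ℕ) (w : Fin n → W),
    (∀ i, w i ∈ 𝒲 (p i)) ∧
    t = PiTensorProduct.tprod k w - (koszulSign σ p : k) • PiTensorProduct.tprod k (w ∘ σ)}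

/-- The graded symmetric power `Sⁿ(W)`: the coinvariants of `W^{⊗ n}` under the symmetric group,
acting with Koszul signs. -/
abbrev SymPow (𝒲 : ℕ → Submodule k W) (n : ℕ) : Type _ := (⨂[k]^n W) ⧸ symRel 𝒲 n

/-- The class of `w₀ ⊗ ⋯ ⊗ wₙ₋₁` in `Sⁿ(W)`. -/
def symProd (𝒲 : ℕ → Submodule k W) {n : ℕ} (w : Fin n → W) : SymPow 𝒲 n :=
  (symRel 𝒲 n).mkQ (PiTensorProduct.tprod k w)

/-- The part of degree `m` of `Sⁿ(W)`, for the grading by total degree. -/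
def symDeg (𝒲 : ℕ → Submodule k W) (n m : ℕ) : Submodule k (SymPow 𝒲 n) :=
  Submodule.span k {t | ∃ (p : Fin n → ℕ) (w : Fin n → W),
    (∀ i, w i ∈ 𝒲 (p i)) ∧ ∑ i, p i = m ∧ t = symProd 𝒲 w}

/-- An endomorphism of degree `-1` of an `ℕ`-graded vector space. -/
structure HasDegNegOne (𝒲 : ℕ → Submodule k W) (d : W →ₗ[k] W) : Prop where
  zero : ∀ w ∈ 𝒲 0, d w = 0
  succ : ∀ m, ∀ w ∈ 𝒲 (m + 1), d w ∈ 𝒲 m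

/-- The differential of `W^{⊗ n}`:
`w₀ ⊗ ⋯ ⊗ wₙ₋₁ ↦ ∑ᵢ (-1)^(|w₀| + ⋯ + |wᵢ₋₁|) w₀ ⊗ ⋯ ⊗ d wᵢ ⊗ ⋯ ⊗ wₙ₋₁`. -/
def tensorD (𝒲 : ℕ → Submodule k W) [DirectSum.Decomposition 𝒲] (d : W →ₗ[k] W) (n : ℕ) :
    (⨂[k]^n W) →ₗ[k] (⨂[k]^n W) :=
  ∑ i : Fin n, PiTensorProduct.map
    fun j => if j < i then parity 𝒲 else if j = i then d else LinearMap.id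

theorem tensorD_tprod (𝒲 : ℕ → Submodule k W) [DirectSum.Decomposition 𝒲] (d : W →ₗ[k] W)
    {n : ℕ} (p : Fin n → ℕ) (w : Fin n → W) (hw : ∀ i, w i ∈ 𝒲 (p i)) :
    tensorD 𝒲 d n (PiTensorProduct.tprod k w) =
      ∑ i : Fin n, (∏ j : Fin n, if j < i then (-1 : k) ^ p j else 1) •
        PiTensorProduct.tprod k (Function.update w i (d (w i))) := by
  simp only [tensorD, LinearMap.sum_apply, PiTensorProduct.map_tprod]
  refine Finset.sum_congr rfl fun i _ => ?_
  rw [← MultilinearMap.map_smul_univ]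
  congr 1
  funext j
  rcases lt_trichotomy j i with h | h | h
  · simp [h, h.ne, parity_of_mem 𝒲 (hw j)]
  · subst h; simp
  · simp [h.not_gt, h.ne']

/-- Lowering the degree of one factor changes the Koszul sign as the graded Leibniz rule asks. -/
theorem koszulSign_update {n : ℕ} (σ : Equiv.Perm (Fin n)) (p : Fin n → ℕ) (i : Fin n) (m : ℕ)
    (hm : p (σ i) = m + 1) :
    (koszulSign σ p : k) * (∏ j : Fin n, if j < i then (-1 : k) ^ p (σ j) else 1) =
      (∏ j : Fin n, if j < σ i then (-1 : k) ^ p j else 1) *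
        koszulSign σ (Function.update p (σ i) m) := by
  have hre : (∏ j : Fin n, if j < σ i then (-1 : k) ^ p j else 1) =
      ∏ j : Fin n, if σ j < σ i then (-1 : k) ^ p (σ j) else 1 :=
    (Equiv.prod_comp σ (fun j => if j < σ i then (-1 : k) ^ p j else 1)).symm
  have hsq : ∀ e : ℕ, ((-1 : k) ^ e) * (-1) ^ e = 1 := fun e => by
    rw [← mul_pow]; simp
  have key : (koszulSign σ p : k) = koszulSign σ (Function.update p (σ i) m) *
      ((∏ b : Fin n, if i < b ∧ σ b < σ i then (-1 : k) ^ p (σ b) else 1) *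
        ∏ a : Fin n, if a < i ∧ σ i < σ a then (-1 : k) ^ p (σ a) else 1) := by
    have h1 : (∏ b : Fin n, if i < b ∧ σ b < σ i then (-1 : k) ^ p (σ b) else 1) =
        ∏ a : Fin n, ∏ b : Fin n,
          if a = i then (if i < b ∧ σ b < σ i then (-1 : k) ^ p (σ b) else 1) else 1 := by
      symm
      rw [Finset.prod_eq_single i]
      · simp
      · intro a _ ha; simp [ha]
      · simp
    have h2 : (∏ a : Fin n, if a < i ∧ σ i < σ a then (-1 : k) ^ p (σ a) else 1) =
        ∏ a : Fin n, ∏ b : Fin n,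
          if b = i then (if a < i ∧ σ i < σ a then (-1 : k) ^ p (σ a) else 1) else 1 := by
      refine Finset.prod_congr rfl fun a _ => ?_
      rw [Finset.prod_eq_single i]
      · simp
      · intro b _ hb; simp [hb]
      · simp
    rw [h1, h2]
    simp only [koszulSign, ← Finset.prod_mul_distrib]
    refine Finset.prod_congr rfl fun a _ => Finset.prod_congr rfl fun b _ => ?_
    by_cases ha : a = i
    · subst ha
      by_cases hb : b = a
      · subst hb; simp
      · have hb' : σ b ≠ σ a := fun h => hb (σ.injective h)
        by_cases hab : a < b ∧ σ b < σ a
        · simp [hab, hb, hb', hm, add_mul, pow_add]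
        · simp [hab, hb]
    · have ha' : σ a ≠ σ i := fun h => ha (σ.injective h)
      by_cases hb : b = i
      · subst hb
        by_cases hab : a < b ∧ σ b < σ a
        · simp [hab, ha, ha', hm, mul_add, pow_add]
        · simp [hab, ha]
      · have hb' : σ b ≠ σ i := fun h => hb (σ.injective h)
        simp [ha, hb, ha', hb']
  rw [key, hre, mul_comm _ (koszulSign σ _), mul_assoc]
  congr 1
  rw [← Finset.prod_mul_distrib, ← Finset.prod_mul_distrib]
  refine Finset.prod_congr rfl fun j _ => ?_
  rcases lt_trichotomy j i with h | h | h
  · have hne : σ j ≠ σ i := fun e => h.ne (σ.injective e)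
    rcases lt_or_gt_of_ne hne with h' | h'
    · simp [h, h', h.not_gt, h'.not_gt]
    · simp [h, h', h.not_gt, h'.not_gt, hsq]
  · subst h; simp
  · by_cases h' : σ j < σ i
    · simp [h, h', h.not_gt]
    · simp [h', h.not_gt]

theorem symRel_le_comap (𝒲 : ℕ → Submodule k W) [DirectSum.Decomposition 𝒲] (d : W →ₗ[k] W)
    (hd : HasDegNegOne 𝒲 d) (n : ℕ) :
    symRel 𝒲 n ≤ (symRel 𝒲 n).comap (tensorD 𝒲 d n) := by
  refine Submodule.span_le.2 ?_
  rintro t ⟨σ, p, w, hw, rfl⟩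
  simp only [SetLike.mem_coe, Submodule.mem_comap, map_sub, map_smul]
  rw [tensorD_tprod 𝒲 d p w hw, tensorD_tprod 𝒲 d (p ∘ σ) (w ∘ σ) (fun i => hw (σ i)),
    ← Equiv.sum_comp σ, Finset.smul_sum, ← Finset.sum_sub_distrib]
  refine Submodule.sum_mem _ fun i _ => ?_
  have hupd : Function.update (w ∘ σ) i (d ((w ∘ σ) i)) =
      Function.update w (σ i) (d (w (σ i))) ∘ σ := by
    funext j
    by_cases h : j = i
    · subst h; simp
    · have h' : σ j ≠ σ i := fun e => h (σ.injective e)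
      simp [h, h']
  rw [hupd, smul_smul]
  rcases hp : p (σ i) with _ | m
  · have h0 : d (w (σ i)) = 0 := hd.zero _ (hp ▸ hw (σ i))
    have e1 : PiTensorProduct.tprod k (Function.update w (σ i) (d (w (σ i)))) = 0 :=
      (PiTensorProduct.tprod k).map_coord_zero (σ i) (by simp [h0])
    have e2 : PiTensorProduct.tprod k (Function.update w (σ i) (d (w (σ i))) ∘ σ) = 0 :=
      (PiTensorProduct.tprod k).map_coord_zero i (by simp [h0])
    rw [e1, e2]; simp
  · have hk := koszulSign_update (k := k) σ p i m hp
    simp only [Function.comp_apply]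
    rw [hk, mul_smul, ← smul_sub]
    refine Submodule.smul_mem _ _ (Submodule.subset_span ⟨σ, Function.update p (σ i) m,
      Function.update w (σ i) (d (w (σ i))), fun j => ?_, rfl⟩)
    by_cases h : j = σ i
    · subst h
      simpa using hd.succ m _ (hp ▸ hw (σ i))
    · simpa [h] using hw j

/-- The differential of the graded symmetric power `Sⁿ(W, d)`, induced by that of `W^{⊗ n}`. -/
def symD (𝒲 : ℕ → Submodule k W) [DirectSum.Decomposition 𝒲] (d : W →ₗ[k] W)
    (hd : HasDegNegOne 𝒲 d) (n : ℕ) : SymPow 𝒲 n →ₗ[k] SymPow 𝒲 n :=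
  (symRel 𝒲 n).mapQ (symRel 𝒲 n) (tensorD 𝒲 d n) (symRel_le_comap 𝒲 d hd n)

/-- The map `Sⁿ(f)` induced by a map `f` of graded vector spaces. -/
def symMap {W' : Type*} [AddCommGroup W'] [Module k W'] (𝒲 : ℕ → Submodule k W)
    (𝒲' : ℕ → Submodule k W') (f : W →ₗ[k] W') (hf : ∀ m, ∀ w ∈ 𝒲 m, f w ∈ 𝒲' m) (n : ℕ) :
    SymPow 𝒲 n →ₗ[k] SymPow 𝒲' n :=
  (symRel 𝒲 n).mapQ (symRel 𝒲' n) (PiTensorProduct.map fun _ => f) <| by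
    refine Submodule.span_le.2 ?_
    rintro t ⟨σ, p, w, hw, rfl⟩
    refine Submodule.subset_span ⟨σ, p, fun i => f (w i), fun i => hf _ _ (hw i), ?_⟩
    simp only [map_sub, map_smul, PiTensorProduct.map_tprod]
    rfl

end GradedSym

/-! ### Leibniz algebras and the Leibniz complex -/

/-- A (right) Leibniz algebra structure on a `k`-vector space. -/
structure LeibnizAlgebra (k : Type*) [Field k] (g : Type*) [AddCommGroup g] [Module k g] where
  mul : g →ₗ[k] g →ₗ[k] g
  leibniz : ∀ x y z : g, mul x (mul y z) = mul (mul x y) z - mul (mul x z) y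

namespace LeibnizAlgebra

/-- Morphisms of Leibniz algebras. -/
def IsHom {k g h : Type*} [Field k] [AddCommGroup g] [Module k g] [AddCommGroup h] [Module k h]
    (L : LeibnizAlgebra k g) (L' : LeibnizAlgebra k h) (f : g →ₗ[k] h) : Prop :=
  ∀ x y, f (L.mul x y) = L'.mul (f x) (f y)

end LeibnizAlgebra

namespace LeibnizComplex

section Tensor

variable (k : Type*) [Field k] (g : Type*) [AddCommGroup g] [Module k g]

/-- `Tⁿ(s g)` inside `T(s g)`. As `s g` sits in homological degree one, this is also the part of
homological degree `n`. -/
abbrev grading : ℕ → Submodule k (TensorAlgebra k g) :=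
  fun n => LinearMap.range (TensorAlgebra.ι k : g →ₗ[k] TensorAlgebra k g) ^ n

/-- The coproduct of the graded Hopf algebra `T(s g)`, the algebra map to the graded tensor product
(with Koszul signs) for which the elements of `s g` are primitive. -/
def coproduct : TensorAlgebra k g →ₐ[k] (grading k g ᵍ⊗[k] grading k g) :=
  TensorAlgebra.lift k
    (((GradedTensorProduct.includeLeft (grading k g) (grading k g)).toLinearMap +
      (GradedTensorProduct.includeRight (grading k g) (grading k g)).toLinearMap) ∘ₗ
        TensorAlgebra.ι k)

/-- The primitive elements of the graded Hopf algebra `T(s g)`. -/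
def primitives : Submodule k (TensorAlgebra k g) :=
  LinearMap.eqLocus (coproduct k g).toLinearMap
    ((GradedTensorProduct.includeLeft (grading k g) (grading k g)).toLinearMap +
      (GradedTensorProduct.includeRight (grading k g) (grading k g)).toLinearMap)

variable {k g}

/-- The iterated graded commutators of elements of `s g`, with their weight (which is also their
homological degree). -/
inductive IsLieMonomial : ℕ → TensorAlgebra k g → Prop
  | gen (x : g) : IsLieMonomial 1 (TensorAlgebra.ι k x)
  | bracket {m n : ℕ} {X Y : TensorAlgebra k g} (hX : IsLieMonomial m X)
      (hY : IsLieMonomial n Y) :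
      IsLieMonomial (m + n) (X * Y - ((-1 : k) ^ (m * n)) • (Y * X))

variable (k g)

/-- `Lie(s g) ⊆ T(s g)`, the free graded Lie algebra on `s g`, realised as the graded Lie
subalgebra of `T(s g)` (for the graded commutator) that is generated by `s g`. -/
def lie : Submodule k (TensorAlgebra k g) :=
  Submodule.span k {X | ∃ n, IsLieMonomial n X}

variable {k g}

theorem IsLieMonomial.mem_grading {n : ℕ} {X : TensorAlgebra k g} (h : IsLieMonomial n X) :
    X ∈ grading k g n := by
  induction h with
  | gen x => simp [grading]
  | @bracket m n X Y _ _ hX hY =>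
    refine Submodule.sub_mem _ ?_ (Submodule.smul_mem _ _ ?_)
    · exact SetLike.mul_mem_graded hX hY
    · rw [add_comm]; exact SetLike.mul_mem_graded hY hX

variable (k g)

theorem lie_isHomogeneous : (lie k g).IsHomogeneous (grading k g) := by
  intro i x hx
  induction hx using Submodule.span_induction with
  | mem x h =>
    obtain ⟨n, hn⟩ := h
    by_cases hi : n = i
    · subst hi
      rw [DirectSum.decompose_of_mem_same _ hn.mem_grading]
      exact Submodule.subset_span ⟨n, hn⟩
    · rw [DirectSum.decompose_of_mem_ne _ hn.mem_grading hi]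
      exact Submodule.zero_mem _
  | zero => simp
  | add x y _ _ hx hy =>
    rw [DirectSum.decompose_add]; exact Submodule.add_mem _ hx hy
  | smul a x _ hx =>
    rw [DirectSum.decompose_smul]; exact Submodule.smul_mem _ a hx

/-- The grading of `Lie(s g)` induced by that of `T(s g)`. -/
def lieGrading (n : ℕ) : Submodule k (lie k g) := (grading k g n).comap (lie k g).subtype

theorem lieGrading_isInternal : DirectSum.IsInternal (lieGrading k g) := by
  refine (DirectSum.isInternal_submodule_iff_iSupIndep_and_iSup_eq_top _).2 ⟨?_, ?_⟩
  · intro i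
    rw [Submodule.disjoint_def]
    intro x hx hx'
    have h := (DirectSum.Decomposition.isInternal (grading k g)).submodule_iSupIndep i
    rw [Submodule.disjoint_def] at h
    refine Subtype.ext (h _ hx ?_)
    have hle : (⨆ (j) (_ : j ≠ i), lieGrading k g j) ≤
        (⨆ (j) (_ : j ≠ i), grading k g j).comap (lie k g).subtype :=
      iSup₂_le fun j hj => Submodule.comap_mono (le_iSup₂_of_le j hj le_rfl)
    exact hle hx'
  · rw [eq_top_iff]
    rintro ⟨x, hx⟩ -
    classical
    have hsum : (⟨x, hx⟩ : lie k g) = ∑ i ∈ (DirectSum.decompose (grading k g) x).support,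
        ⟨(DirectSum.decompose (grading k g) x i : TensorAlgebra k g),
          lie_isHomogeneous k g i hx⟩ := by
      apply Subtype.ext
      simpa using (DirectSum.sum_support_decompose (grading k g) x).symm
    rw [hsum]
    exact Submodule.sum_mem _ fun i _ => Submodule.mem_iSup_of_mem i
      (DirectSum.decompose (grading k g) x i).2

instance : DirectSum.Decomposition (lieGrading k g) :=
  (lieGrading_isInternal k g).chooseDecomposition

/-- The primitive filtration: `fil n` is the image in `T(s g)` of `⨁_{i ≤ n} Lie(s g)^{⊗ i}`, under
the algebra map `T(Lie(s g)) → T(s g)` which extends the inclusion of `Lie(s g)`. -/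
def fil (n : ℕ) : Submodule k (TensorAlgebra k g) :=
  (⨆ (i : ℕ) (_ : i ≤ n), grading k (lie k g) i).map
    (TensorAlgebra.lift k (lie k g).subtype).toLinearMap

/-- `fil (n - 1)`, with the convention `fil (-1) = 0`. -/
def filPred : ℕ → Submodule k (TensorAlgebra k g)
  | 0 => ⊥
  | n + 1 => fil k g n

/-- The associated graded piece `fil n / fil (n - 1)`. -/
abbrev Gr (n : ℕ) : Type _ := fil k g n ⧸ (filPred k g n).submoduleOf (fil k g n)

/-- The part of homological degree `m` of `fil n / fil (n - 1)`. -/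
def grDeg (n m : ℕ) : Submodule k (Gr k g n) :=
  ((grading k g m).comap (fil k g n).subtype).map
    ((filPred k g n).submoduleOf (fil k g n)).mkQ

end Tensor

section Differential

variable {k : Type*} [Field k] {g : Type*} [AddCommGroup g] [Module k g]

/-- The factors `x₀, …, xᵢ xⱼ, …, (omit xⱼ), …, xₙ` of the summand of the Leibniz differential
that is indexed by `i < j`. -/
def leibArg (L : LeibnizAlgebra k g) {n : ℕ} (i j : Fin (n + 1)) (x : Fin (n + 1) → g) :
    Fin n → g :=
  fun l => Function.update x i (L.mul (x i) (x j)) (j.succAbove l)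

theorem leibArg_update_right (L : LeibnizAlgebra k g) {n : ℕ} (i : Fin n) (j : Fin (n + 1))
    (x : Fin (n + 1) → g) (v : g) :
    leibArg L (j.succAbove i) j (Function.update x j v) =
      Function.update (fun l => x (j.succAbove l)) i (L.mul (x (j.succAbove i)) v) := by
  funext l
  by_cases h : l = i
  · subst h; simp [leibArg, Fin.succAbove_ne]
  · simp [leibArg, h, Fin.succAbove_ne]

theorem leibArg_update_left (L : LeibnizAlgebra k g) {n : ℕ} (i : Fin n) (j : Fin (n + 1))
    (x : Fin (n + 1) → g) (v : g) :
    leibArg L (j.succAbove i) j (Function.update x (j.succAbove i) v) =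
      Function.update (fun l => x (j.succAbove l)) i (L.mul v (x j)) := by
  funext l
  by_cases h : l = i
  · subst h; simp [leibArg, Fin.ne_succAbove]
  · simp [leibArg, h]

theorem leibArg_update_of_ne (L : LeibnizAlgebra k g) {n : ℕ} (i p : Fin n) (j : Fin (n + 1))
    (x : Fin (n + 1) → g) (hp : p ≠ i) (v : g) :
    leibArg L (j.succAbove i) j (Function.update x (j.succAbove p) v) =
      Function.update (leibArg L (j.succAbove i) j x) p v := by
  funext l
  by_cases h : l = i
  · subst h; simp [leibArg, Fin.ne_succAbove, hp.symm]
  · by_cases h2 : l = p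
    · subst h2; simp [leibArg, h]
    · simp [leibArg, h, h2]

/-- The summand of the Leibniz differential indexed by `i < j`, without its sign:
`s x₀ ⊗ ⋯ ⊗ s xₙ ↦ s x₀ ⊗ ⋯ ⊗ s (xᵢ xⱼ) ⊗ ⋯ ⊗ (omit s xⱼ) ⊗ ⋯ ⊗ s xₙ`. -/
def leibTerm (L : LeibnizAlgebra k g) {n : ℕ} (i j : Fin (n + 1)) (hij : i < j) :
    MultilinearMap k (fun _ : Fin (n + 1) => g) (TensorAlgebra k g) where
  toFun x := TensorAlgebra.tprod k g n (leibArg L i j x)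
  map_update_add' := by
    intro inst x p v w
    obtain rfl := Subsingleton.elim inst (instDecidableEqFin (n + 1))
    obtain ⟨i, rfl⟩ := Fin.exists_succAbove_eq hij.ne
    rcases Fin.eq_self_or_eq_succAbove j p with rfl | ⟨p, rfl⟩
    · simp only [leibArg_update_right, map_add, MultilinearMap.map_update_add]
    · by_cases hp : p = i
      · subst hp
        simp only [leibArg_update_left, map_add, LinearMap.add_apply,
          MultilinearMap.map_update_add]
      · simp only [leibArg_update_of_ne L _ _ _ _ hp, MultilinearMap.map_update_add]
  map_update_smul' := by
    intro inst x p c v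
    obtain rfl := Subsingleton.elim inst (instDecidableEqFin (n + 1))
    obtain ⟨i, rfl⟩ := Fin.exists_succAbove_eq hij.ne
    rcases Fin.eq_self_or_eq_succAbove j p with rfl | ⟨p, rfl⟩
    · simp only [leibArg_update_right, map_smul, MultilinearMap.map_update_smul]
    · by_cases hp : p = i
      · subst hp
        simp only [leibArg_update_left, map_smul, LinearMap.smul_apply,
          MultilinearMap.map_update_smul]
      · simp only [leibArg_update_of_ne L _ _ _ _ hp, MultilinearMap.map_update_smul]

/-- The Leibniz differential on tensors of length `n`. The sign `(-1)^(j+1)` of the usual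
formula, where the factors are numbered from `1`, is `(-1)^j` for a numbering from `0`. -/
def leibMultilinear (L : LeibnizAlgebra k g) :
    ∀ n : ℕ, MultilinearMap k (fun _ : Fin n => g) (TensorAlgebra k g)
  | 0 => 0
  | n + 1 => ∑ q : {q : Fin (n + 1) × Fin (n + 1) // q.1 < q.2},
      ((-1 : k) ^ (q.1.2 : ℕ)) • leibTerm L q.1.1 q.1.2 q.2

/-- The Leibniz differential `d` on `T(s g)`. -/
def leibD (L : LeibnizAlgebra k g) : TensorAlgebra k g →ₗ[k] TensorAlgebra k g :=
  (DirectSum.toModule k ℕ (TensorAlgebra k g) fun n => PiTensorProduct.lift (leibMultilinear L n))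
    ∘ₗ (TensorAlgebra.equivDirectSum (R := k) (M := g)).toLinearMap

theorem leibD_tprod (L : LeibnizAlgebra k g) (n : ℕ) (x : Fin n → g) :
    leibD L (TensorAlgebra.tprod k g n x) = leibMultilinear L n x := by
  have h : TensorAlgebra.equivDirectSum (TensorAlgebra.tprod k g n x) =
      DirectSum.lof k ℕ (fun n => ⨂[k]^n g) n (PiTensorProduct.tprod k x) :=
    TensorAlgebra.toDirectSum_tensorPower_tprod x
  simp only [leibD, LinearMap.comp_apply, AlgEquiv.toLinearMap_apply]
  rw [h, DirectSum.toModule_lof, PiTensorProduct.lift.tprod]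

theorem tprod_mem_grading (n : ℕ) (x : Fin n → g) :
    TensorAlgebra.tprod k g n x ∈ grading k g n := by
  rw [TensorAlgebra.tprod_apply]
  have h := SetLike.list_prod_ofFn_mem_graded (A := grading k g) (fun _ : Fin n => 1)
    (fun i => TensorAlgebra.ι k (x i)) (fun i => by simp [grading])
  simpa using h

theorem grading_eq_span (n : ℕ) :
    grading k g n = Submodule.span k (Set.range (TensorAlgebra.tprod k g n)) := by
  refine le_antisymm ?_ (Submodule.span_le.2 ?_)
  · induction n with
    | zero =>
      rw [grading, pow_zero, Submodule.one_eq_span]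
      refine Submodule.span_mono ?_
      rintro _ rfl
      exact ⟨Fin.elim0, by simp [TensorAlgebra.tprod_apply]⟩
    | succ n ih =>
      change LinearMap.range (TensorAlgebra.ι k : g →ₗ[k] TensorAlgebra k g) ^ (n + 1) ≤ _
      rw [pow_succ', Submodule.mul_le]
      rintro _ ⟨v, rfl⟩ y hy
      replace hy := ih hy
      induction hy using Submodule.span_induction with
      | mem y h =>
        obtain ⟨x, rfl⟩ := h
        exact Submodule.subset_span ⟨Fin.cons v x, by simp [TensorAlgebra.tprod_apply]⟩
      | zero => simp
      | add a b _ _ ha hb => rw [mul_add]; exact Submodule.add_mem _ ha hb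
      | smul c a _ ha => rw [mul_smul_comm]; exact Submodule.smul_mem _ c ha
  · rintro _ ⟨x, rfl⟩
    exact tprod_mem_grading n x

theorem leibD_hasDegNegOne (L : LeibnizAlgebra k g) :
    GradedSym.HasDegNegOne (grading k g) (leibD L) := by
  constructor
  · intro w hw
    rw [grading_eq_span] at hw
    induction hw using Submodule.span_induction with
    | mem x h => obtain ⟨x, rfl⟩ := h; rw [leibD_tprod]; rfl
    | zero => simp
    | add x y _ _ hx hy => rw [map_add, hx, hy, add_zero]
    | smul a x _ hx => rw [map_smul, hx, smul_zero]
  · intro m w hw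
    rw [grading_eq_span] at hw
    induction hw using Submodule.span_induction with
    | mem x h =>
      obtain ⟨x, rfl⟩ := h
      rw [leibD_tprod]
      simp only [leibMultilinear, sum_apply, smul_apply]
      exact Submodule.sum_mem _ fun q _ => Submodule.smul_mem _ _ (tprod_mem_grading _ _)
    | zero => simp
    | add x y _ _ hx hy => rw [map_add]; exact Submodule.add_mem _ hx hy
    | smul a x _ hx => rw [map_smul]; exact Submodule.smul_mem _ a hx

/-- A subcomplex of the Leibniz complex: a graded subspace that is stable under the
differential. -/
structure IsSubcomplex (L : LeibnizAlgebra k g) (F : Submodule k (TensorAlgebra k g)) : Prop where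
  isHomogeneous : F.IsHomogeneous (grading k g)
  stable : ∀ x ∈ F, leibD L x ∈ F

/-- The differential of `Lie(s g)`, once this is known to be a subcomplex. -/
def lieD (L : LeibnizAlgebra k g) (h : IsSubcomplex L (lie k g)) : lie k g →ₗ[k] lie k g :=
  (leibD L).restrict h.stable

theorem lieD_hasDegNegOne (L : LeibnizAlgebra k g) (h : IsSubcomplex L (lie k g)) :
    GradedSym.HasDegNegOne (lieGrading k g) (lieD L h) where
  zero _ hw := Subtype.ext ((leibD_hasDegNegOne L).zero _ hw)
  succ m _ hw := (leibD_hasDegNegOne L).succ m _ hw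

/-- The complex `Sⁿ(Lie(s g), d)`: its underlying space. -/
abbrev SymLie (k : Type*) [Field k] (g : Type*) [AddCommGroup g] [Module k g] (n : ℕ) : Type _ :=
  GradedSym.SymPow (lieGrading k g) n

/-- The complex `Sⁿ(Lie(s g), d)`: its differential. -/
def symLieD (L : LeibnizAlgebra k g) (h : IsSubcomplex L (lie k g)) (n : ℕ) :
    SymLie k g n →ₗ[k] SymLie k g n :=
  GradedSym.symD (lieGrading k g) (lieD L h) (lieD_hasDegNegOne L h) n

theorem filPred_stable (L : LeibnizAlgebra k g) (h : ∀ n, IsSubcomplex L (fil k g n)) (n : ℕ) :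
    ∀ x ∈ filPred k g n, leibD L x ∈ filPred k g n := by
  cases n with
  | zero => intro x hx; rw [(Submodule.mem_bot k).1 hx, map_zero]; exact Submodule.zero_mem _
  | succ n => exact (h n).stable

/-- The differential of the quotient complex `fil n / fil (n - 1)`. -/
def grD (L : LeibnizAlgebra k g) (h : ∀ n, IsSubcomplex L (fil k g n)) (n : ℕ) :
    Gr k g n →ₗ[k] Gr k g n :=
  ((filPred k g n).submoduleOf (fil k g n)).mapQ ((filPred k g n).submoduleOf (fil k g n))
    ((leibD L).restrict (h n).stable) fun x hx => filPred_stable L h n x hx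

end Differential

section Functoriality

variable {k : Type*} [Field k] {g h : Type*} [AddCommGroup g] [Module k g]
  [AddCommGroup h] [Module k h]

/-- The map `T(s f) : T(s g) → T(s h)`. -/
abbrev tmap (f : g →ₗ[k] h) : TensorAlgebra k g →ₐ[k] TensorAlgebra k h :=
  TensorAlgebra.lift k (TensorAlgebra.ι k ∘ₗ f)

theorem tmap_mem_grading (f : g →ₗ[k] h) (n : ℕ) (x : TensorAlgebra k g)
    (hx : x ∈ grading k g n) : tmap f x ∈ grading k h n := by
  have : (grading k g n).map (tmap f).toLinearMap ≤ grading k h n := by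
    rw [Submodule.map_pow]
    refine pow_le_pow_left' ?_ n
    rintro _ ⟨_, ⟨x, rfl⟩, rfl⟩
    exact ⟨f x, by simp⟩
  exact this ⟨x, hx, rfl⟩

theorem IsLieMonomial.tmap (f : g →ₗ[k] h) {n : ℕ} {X : TensorAlgebra k g}
    (hX : IsLieMonomial n X) : IsLieMonomial n (LeibnizComplex.tmap f X) := by
  induction hX with
  | gen x => simpa using IsLieMonomial.gen (f x)
  | bracket _ _ hX hY =>
    rw [map_sub, map_smul, map_mul, map_mul]
    exact hX.bracket hY

theorem tmap_mem_lie (f : g →ₗ[k] h) (x : TensorAlgebra k g) (hx : x ∈ lie k g) :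
    tmap f x ∈ lie k h := by
  have : lie k g ≤ (lie k h).comap (tmap f).toLinearMap :=
    Submodule.span_le.2 fun X ⟨n, hX⟩ => Submodule.subset_span ⟨n, hX.tmap f⟩
  exact this hx

/-- The map `Lie(s f) : Lie(s g) → Lie(s h)`. -/
def lieMap (f : g →ₗ[k] h) : lie k g →ₗ[k] lie k h :=
  (tmap f).toLinearMap.restrict (tmap_mem_lie f)

/-- The map `Sⁿ(Lie(s f))`. -/
def symLieMap (f : g →ₗ[k] h) (n : ℕ) : SymLie k g n →ₗ[k] SymLie k h n :=
  GradedSym.symMap (lieGrading k g) (lieGrading k h) (lieMap f)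
    (fun m _ hw => tmap_mem_grading f m _ hw) n

theorem tmap_mem_fil (f : g →ₗ[k] h) (n : ℕ) (x : TensorAlgebra k g) (hx : x ∈ fil k g n) :
    tmap f x ∈ fil k h n := by
  obtain ⟨y, hy, rfl⟩ := hx
  refine ⟨tmap (lieMap f) y, ?_, ?_⟩
  · have hle : (⨆ (i : ℕ) (_ : i ≤ n), grading k (lie k g) i) ≤
        (⨆ (i : ℕ) (_ : i ≤ n), grading k (lie k h) i).comap (tmap (lieMap f)).toLinearMap :=
      iSup₂_le fun i hi z hz =>
        (le_iSup₂_of_le (f := fun (i : ℕ) (_ : i ≤ n) => grading k (lie k h) i) i hi le_rfl)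
          (tmap_mem_grading (lieMap f) i z hz)
    exact hle hy
  · have : (TensorAlgebra.lift k (lie k h).subtype).comp (tmap (lieMap f)) =
        (tmap f).comp (TensorAlgebra.lift k (lie k g).subtype) := by
      ext z
      simp only [AlgHom.toLinearMap_apply, LinearMap.comp_apply, AlgHom.comp_apply,
        TensorAlgebra.lift_ι_apply, Submodule.subtype_apply]
      rfl
    exact DFunLike.congr_fun this y

/-- The map `fil n / fil (n - 1)` on associated graded pieces that is induced by `T(s f)`. -/
def grMap (f : g →ₗ[k] h) (n : ℕ) : Gr k g n →ₗ[k] Gr k h n :=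
  ((filPred k g n).submoduleOf (fil k g n)).mapQ ((filPred k h n).submoduleOf (fil k h n))
    ((tmap f).toLinearMap.restrict (tmap_mem_fil f n)) <| by
      intro x hx
      cases n with
      | zero =>
        have h0 : (x : TensorAlgebra k g) = 0 := (Submodule.mem_bot k).1 hx
        refine (Submodule.mem_bot k).2 ?_
        change tmap f (x : TensorAlgebra k g) = 0
        rw [h0, map_zero]
      | succ n => exact tmap_mem_fil f n x hx

end Functoriality

end LeibnizComplex

end

/-! Write D_v for the derivation of the algebra T(sg) that extends right multiplication x ↦ xv, and
sgn for the sign automorphism. Separating the summands with j = n from the others gives d(w·sv) =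
d(w)·sv + D_v(sgn w) (`leibD_mul_ι`). The Leibniz identity says [D_v, D_u] = D_{uv}; hence d
commutes with every D_v (`leibD_deriv`), and d² = 0 follows by induction on length.

For X in Lie(sg) the formula becomes d(wX) = d(w)X + sgn(w)d(X) + D_x(sgn w) for some x in g
(`leibD_mul_of_mem_lie`). Derivations extending endomorphisms of g preserve Lie(sg) and each f_n, so
d does too. The last term has one Lie factor fewer than wX, so modulo lower filtration d obeys the
graded Leibniz rule on products of Lie elements (`leibD_lieProd_sub_mem`).

Commuting two neighbouring Lie factors costs a commutator, a single Lie element. The product is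
therefore graded symmetric modulo f_{n-1} and induces S^n(Lie(sg)) → f_n/f_{n-1}, which is onto
because f_n = f_{n-1} + Lie(sg)^n.

Injectivity is the Poincaré–Birkhoff–Witt part, and uses the coproduct. The convolution of the
Dynkin operator with the identity is multiplication by the degree (`dynkin_convolution`). In
characteristic zero this shows that primitives lie in Lie(sg), and that Dynkin divided by the degree
projects T(sg) onto Lie(sg). The n-fold convolution power of this projection, with values in
S^n(Lie(sg)), kills f_{n-1} (`symbol_eq_zero`) and sends X_1⋯X_n to n! times its class
(`symbol_lieProd`); up to n! it is a left inverse. -/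

namespace LeibnizComplex

/-! ### Induction on tensor length, the sign automorphism and derivations of T(sg) -/

section TensorAlgebra

variable {k : Type*} [Field k] {g : Type*} [AddCommGroup g] [Module k g]

theorem tprod_snoc (n : ℕ) (x : Fin n → g) (v : g) :
    TensorAlgebra.tprod k g (n + 1) (Fin.snoc x v) =
      TensorAlgebra.tprod k g n x * TensorAlgebra.ι k v := by
  simp only [TensorAlgebra.tprod_apply, List.ofFn_succ', Fin.snoc_castSucc, Fin.snoc_last]
  simp

theorem tprod_cons (n : ℕ) (x : Fin n → g) (v : g) :
    TensorAlgebra.tprod k g (n + 1) (Fin.cons v x) =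
      TensorAlgebra.ι k v * TensorAlgebra.tprod k g n x := by
  simp [TensorAlgebra.tprod_apply]

theorem tprod_zero' (x : Fin 0 → g) : TensorAlgebra.tprod k g 0 x = 1 := by
  simp [TensorAlgebra.tprod_apply]

theorem span_tprod_eq_top :
    Submodule.span k {w | ∃ n x, w = TensorAlgebra.tprod k g n x} = ⊤ := by
  rw [eq_top_iff]
  intro w _
  induction w using DirectSum.Decomposition.inductionOn (grading k g) with
  | zero => exact Submodule.zero_mem _
  | @homogeneous i m =>
    obtain ⟨m, hm⟩ := m
    rw [grading_eq_span] at hm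
    refine Submodule.span_mono ?_ hm
    rintro _ ⟨x, rfl⟩
    exact ⟨i, x, rfl⟩
  | add a b ha hb => exact Submodule.add_mem _ (ha trivial) (hb trivial)

theorem ext_tprod {U : Type*} [AddCommGroup U] [Module k U] {f h : TensorAlgebra k g →ₗ[k] U}
    (H : ∀ n x, f (TensorAlgebra.tprod k g n x) = h (TensorAlgebra.tprod k g n x)) : f = h := by
  refine LinearMap.ext_on_range (v := fun p : Σ n, Fin n → g => TensorAlgebra.tprod k g p.1 p.2) ?_
    fun p => H p.1 p.2
  rw [← span_tprod_eq_top]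
  congr 1
  ext w
  exact ⟨fun ⟨p, hp⟩ => ⟨p.1, p.2, hp.symm⟩, fun ⟨n, x, hx⟩ => ⟨⟨n, x⟩, hx.symm⟩⟩

/-- Tensors are built by appending generators on the right, the side on which the differential has a
simple recursion. The left-handed `ext_ι_mul` serves the coproduct and the Dynkin operator. -/
theorem ext_mul_ι {U : Type*} [AddCommGroup U] [Module k U] {f h : TensorAlgebra k g →ₗ[k] U}
    (one : f 1 = h 1)
    (mul : ∀ w v, f w = h w → f (w * TensorAlgebra.ι k v) = h (w * TensorAlgebra.ι k v)) :
    f = h := by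
  refine ext_tprod fun n => ?_
  induction n with
  | zero => intro x; rwa [tprod_zero']
  | succ n ih =>
    intro x
    rw [← Fin.snoc_init_self x, tprod_snoc]
    exact mul _ _ (ih _)

theorem ext_ι_mul {U : Type*} [AddCommGroup U] [Module k U] {f h : TensorAlgebra k g →ₗ[k] U}
    (one : f 1 = h 1)
    (mul : ∀ w v, f w = h w → f (TensorAlgebra.ι k v * w) = h (TensorAlgebra.ι k v * w)) :
    f = h := by
  refine ext_tprod fun n => ?_
  induction n with
  | zero => intro x; rwa [tprod_zero']
  | succ n ih =>
    intro x
    rw [← Fin.cons_self_tail x, tprod_cons]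
    exact mul _ _ (ih _)

variable (k g) in
/-- The sign automorphism `w ↦ (-1)^|w| w` of the algebra `T(s g)`. -/
noncomputable def sgn : TensorAlgebra k g →ₐ[k] TensorAlgebra k g :=
  TensorAlgebra.lift k (-TensorAlgebra.ι k)

@[simp] theorem sgn_ι (v : g) : sgn k g (TensorAlgebra.ι k v) = -TensorAlgebra.ι k v := by
  simp [sgn]

theorem sgn_of_mem {n : ℕ} {w : TensorAlgebra k g} (hw : w ∈ grading k g n) :
    sgn k g w = (-1 : k) ^ n • w := by
  rw [grading_eq_span] at hw
  induction hw using Submodule.span_induction with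
  | mem w h =>
    obtain ⟨x, rfl⟩ := h
    induction n with
    | zero => simp
    | succ n ih =>
      rw [← Fin.cons_self_tail x, tprod_cons, map_mul, ih, sgn_ι]
      simp [pow_succ]
  | zero => simp
  | add a b _ _ ha hb => rw [map_add, ha, hb, smul_add]
  | smul c a _ ha => rw [map_smul, ha, smul_comm]

theorem ι_mem_grading (v : g) : TensorAlgebra.ι k v ∈ grading k g 1 := by simp [grading]

theorem one_mem_grading : (1 : TensorAlgebra k g) ∈ grading k g 0 := SetLike.GradedOne.one_mem

theorem mul_mem_grading {m n : ℕ} {a b : TensorAlgebra k g} (ha : a ∈ grading k g m)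
    (hb : b ∈ grading k g n) : a * b ∈ grading k g (m + n) := SetLike.mul_mem_graded ha hb

/-- The algebra map `w ↦ w + ε D w` for the derivation `D` of `T(s g)` which extends a linear
endomorphism of `g`. -/
noncomputable def derivHom (φ : g →ₗ[k] g) :
    TensorAlgebra k g →ₐ[k] TrivSqZeroExt (TensorAlgebra k g) (TensorAlgebra k g) :=
  TensorAlgebra.lift k
    ((TrivSqZeroExt.inlAlgHom k (TensorAlgebra k g) (TensorAlgebra k g)).toLinearMap ∘ₗ
        TensorAlgebra.ι k +
      (TrivSqZeroExt.inrHom (TensorAlgebra k g) (TensorAlgebra k g)).restrictScalars k ∘ₗ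
        TensorAlgebra.ι k ∘ₗ φ)

theorem fst_derivHom (φ : g →ₗ[k] g) (w : TensorAlgebra k g) : (derivHom φ w).fst = w := by
  have : (TrivSqZeroExt.fstHom k (TensorAlgebra k g) (TensorAlgebra k g)).comp (derivHom φ) =
      AlgHom.id k _ := by
    ext v; simp [derivHom]
  exact DFunLike.congr_fun this w

/-- The derivation of `T(s g)` which extends a linear endomorphism of `g`. -/
noncomputable def deriv (φ : g →ₗ[k] g) : TensorAlgebra k g →ₗ[k] TensorAlgebra k g :=
  TrivSqZeroExt.sndHom (TensorAlgebra k g) (TensorAlgebra k g) |>.restrictScalars k |>.comp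
    (derivHom φ).toLinearMap

@[simp] theorem deriv_ι (φ : g →ₗ[k] g) (v : g) :
    deriv φ (TensorAlgebra.ι k v) = TensorAlgebra.ι k (φ v) := by
  simp [deriv, derivHom]

theorem deriv_mul (φ : g →ₗ[k] g) (a b : TensorAlgebra k g) :
    deriv φ (a * b) = deriv φ a * b + a * deriv φ b := by
  simp [deriv, fst_derivHom, add_comm]

@[simp] theorem deriv_one (φ : g →ₗ[k] g) : deriv φ (1 : TensorAlgebra k g) = 0 := by
  simp [deriv]

@[simp] theorem deriv_zero (w : TensorAlgebra k g) : deriv (0 : g →ₗ[k] g) w = 0 := by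
  have : deriv (0 : g →ₗ[k] g) = 0 := ext_mul_ι (by simp) fun w v h => by
    simp_all [deriv_mul]
  rw [this, LinearMap.zero_apply]

theorem deriv_add (φ ψ : g →ₗ[k] g) (w : TensorAlgebra k g) :
    deriv (φ + ψ) w = deriv φ w + deriv ψ w := by
  have : deriv (φ + ψ) = deriv φ + deriv ψ := ext_mul_ι (by simp) fun w v h => by
    simp only [LinearMap.add_apply] at h ⊢
    simp only [deriv_mul, h, deriv_ι, LinearMap.add_apply, map_add]
    noncomm_ring
  rw [this, LinearMap.add_apply]

theorem deriv_smul (c : k) (φ : g →ₗ[k] g) (w : TensorAlgebra k g) :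
    deriv (c • φ) w = c • deriv φ w := by
  have : deriv (c • φ) = c • deriv φ := ext_mul_ι (by simp) fun w v h => by
    simp only [LinearMap.smul_apply] at h ⊢
    simp only [deriv_mul, h, deriv_ι, LinearMap.smul_apply, map_smul, smul_add, smul_mul_assoc,
      mul_smul_comm]
  rw [this, LinearMap.smul_apply]

theorem deriv_tprod (φ : g →ₗ[k] g) (n : ℕ) (x : Fin n → g) :
    deriv φ (TensorAlgebra.tprod k g n x) =
      ∑ i, TensorAlgebra.tprod k g n (Function.update x i (φ (x i))) := by
  induction n with
  | zero => simp
  | succ n ih =>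
    obtain ⟨y, v, rfl⟩ : ∃ y v, x = Fin.snoc y v := ⟨_, _, (Fin.snoc_init_self x).symm⟩
    rw [tprod_snoc, deriv_mul, ih, Fin.sum_univ_castSucc, Finset.sum_mul]
    congr 1
    · refine Finset.sum_congr rfl fun i _ => ?_
      rw [Fin.snoc_castSucc, ← Fin.snoc_update, tprod_snoc]
    · rw [Fin.snoc_last, Fin.update_snoc_last, tprod_snoc, deriv_ι]

theorem deriv_mem_grading (φ : g →ₗ[k] g) {n : ℕ} {w : TensorAlgebra k g}
    (hw : w ∈ grading k g n) : deriv φ w ∈ grading k g n := by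
  rw [grading_eq_span] at hw
  induction hw using Submodule.span_induction with
  | mem w h =>
    obtain ⟨x, rfl⟩ := h
    rw [deriv_tprod]
    exact Submodule.sum_mem _ fun i _ => tprod_mem_grading _ _
  | zero => simp
  | add a b _ _ ha hb => rw [map_add]; exact Submodule.add_mem _ ha hb
  | smul c a _ ha => rw [map_smul]; exact Submodule.smul_mem _ _ ha

theorem sgn_deriv (φ : g →ₗ[k] g) (w : TensorAlgebra k g) :
    sgn k g (deriv φ w) = deriv φ (sgn k g w) := by
  have : (sgn k g).toLinearMap ∘ₗ deriv φ = deriv φ ∘ₗ (sgn k g).toLinearMap :=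
    ext_tprod fun n x => by
      have h := tprod_mem_grading (k := k) n x
      simp only [LinearMap.comp_apply, AlgHom.toLinearMap_apply, sgn_of_mem h,
        sgn_of_mem (deriv_mem_grading φ h), map_smul]
  exact LinearMap.congr_fun this w

/-- A commutator of derivations is a derivation, so it is determined by its values on generators. -/
theorem deriv_comm (φ ψ : g →ₗ[k] g) (w : TensorAlgebra k g) :
    deriv φ (deriv ψ w) = deriv ψ (deriv φ w) + deriv (φ ∘ₗ ψ - ψ ∘ₗ φ) w := by
  have : deriv φ ∘ₗ deriv ψ = deriv ψ ∘ₗ deriv φ + deriv (φ ∘ₗ ψ - ψ ∘ₗ φ) :=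
    ext_mul_ι (by simp) fun w v h => by
      simp only [LinearMap.comp_apply, LinearMap.add_apply] at h ⊢
      simp only [deriv_mul, map_add, deriv_ι, h, LinearMap.sub_apply, LinearMap.comp_apply, map_sub]
      noncomm_ring
  exact LinearMap.congr_fun this w

end TensorAlgebra

/-! ### Recursion for the Leibniz differential, and d² = 0 -/

section Differential

variable {k : Type*} [Field k] {g : Type*} [AddCommGroup g] [Module k g] (L : LeibnizAlgebra k g)

@[simp] theorem leibD_one : leibD L 1 = 0 :=
  (leibD_hasDegNegOne L).zero _ one_mem_grading

/-- With j as the outer index, the summands that remove the last factor form the last term of the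
outer sum. -/
theorem leibMultilinear_succ (n : ℕ) (x : Fin (n + 1) → g) :
    leibMultilinear L (n + 1) x = ∑ j : Fin (n + 1), ∑ i : Fin (n + 1),
      if i < j then (-1 : k) ^ (j : ℕ) • TensorAlgebra.tprod k g n (leibArg L i j x) else 0 := by
  rw [Finset.sum_comm, ← Finset.sum_product' (f := fun i j : Fin (n + 1) => if i < j then
    (-1 : k) ^ (j : ℕ) • TensorAlgebra.tprod k g n (leibArg L i j x) else 0),
    ← Finset.sum_filter, Finset.univ_product_univ]
  simp only [leibMultilinear, sum_apply, smul_apply]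
  exact (Finset.sum_subtype (p := fun q : Fin (n + 1) × Fin (n + 1) => q.1 < q.2) _ (by simp)
    (fun q => (-1 : k) ^ (q.2 : ℕ) • TensorAlgebra.tprod k g n (leibArg L q.1 q.2 x))).symm

theorem leibArg_snoc_last (n : ℕ) (x : Fin n → g) (v : g) (i : Fin n) :
    leibArg L i.castSucc (Fin.last n) (Fin.snoc x v) =
      Function.update x i (L.mul (x i) v) := by
  funext l
  by_cases h : l = i
  · subst h; simp [leibArg]
  · simp [leibArg, h]

theorem leibArg_snoc_castSucc (n : ℕ) (x : Fin (n + 1) → g) (v : g) (i j : Fin (n + 1)) :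
    leibArg L i.castSucc j.castSucc (Fin.snoc x v) =
      Fin.snoc (leibArg L i j x) v := by
  have : Function.update (Fin.snoc x v : Fin (n + 2) → g) i.castSucc (L.mul (x i) (x j)) =
      Fin.snoc (Function.update x i (L.mul (x i) (x j))) v := (Fin.snoc_update ..).symm
  funext l
  simp only [leibArg, Fin.snoc_castSucc, this]
  induction l using Fin.lastCases with
  | last =>
    have h : j.castSucc.succAbove (Fin.last n) = Fin.last (n + 1) := by
      rw [Fin.succAbove_of_le_castSucc _ _ (by simpa using Fin.le_last j), Fin.succ_last]
    rw [h, Fin.snoc_last, Fin.snoc_last]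
  | cast l =>
    rw [Fin.castSucc_succAbove_castSucc]
    simp [leibArg]

/-- Summands with j before the last position leave the factor v untouched. Those with j last
multiply v into each earlier factor in turn, with the common sign (-1)^|w|: this is the derivation
applied to sgn w. -/
theorem leibD_mul_ι (w : TensorAlgebra k g) (v : g) :
    leibD L (w * TensorAlgebra.ι k v) =
      leibD L w * TensorAlgebra.ι k v + deriv (L.mul.flip v) (sgn k g w) := by
  have : leibD L ∘ₗ LinearMap.mulRight k (TensorAlgebra.ι k v) =
      LinearMap.mulRight k (TensorAlgebra.ι k v) ∘ₗ leibD L +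
        deriv (L.mul.flip v) ∘ₗ (sgn k g).toLinearMap := by
    refine ext_tprod fun n x => ?_
    have h := tprod_mem_grading (k := k) n x
    simp only [LinearMap.comp_apply, LinearMap.mulRight_apply, LinearMap.add_apply,
      AlgHom.toLinearMap_apply, sgn_of_mem h, map_smul]
    rw [← tprod_snoc, leibD_tprod, leibD_tprod, leibMultilinear_succ, Fin.sum_univ_castSucc]
    congr 1
    · cases n with
      | zero => simp [leibMultilinear]
      | succ n =>
        rw [leibMultilinear_succ, Finset.sum_mul]
        refine Finset.sum_congr rfl fun j _ => ?_
        rw [Fin.sum_univ_castSucc, Finset.sum_mul, if_neg (Fin.le_last _).not_gt, add_zero]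
        refine Finset.sum_congr rfl fun i _ => ?_
        by_cases hij : i < j
        · rw [if_pos hij, if_pos (Fin.castSucc_lt_castSucc_iff.2 hij),
            leibArg_snoc_castSucc L n x v i j, tprod_snoc, smul_mul_assoc, Fin.val_castSucc]
        · rw [if_neg hij, if_neg (by simpa using hij), zero_mul]
    · rw [deriv_tprod, Fin.sum_univ_castSucc, if_neg (lt_irrefl _), add_zero, Finset.smul_sum]
      refine Finset.sum_congr rfl fun i _ => ?_
      rw [if_pos (Fin.castSucc_lt_last i), leibArg_snoc_last]
      simp
  exact LinearMap.congr_fun this w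

@[simp] theorem leibD_ι (v : g) : leibD L (TensorAlgebra.ι k v) = 0 := by
  simpa using leibD_mul_ι L 1 v

theorem sgn_leibD (w : TensorAlgebra k g) : sgn k g (leibD L w) = -leibD L (sgn k g w) := by
  have : (sgn k g).toLinearMap ∘ₗ leibD L = -(leibD L ∘ₗ (sgn k g).toLinearMap) :=
    ext_tprod fun n x => by
      have h := tprod_mem_grading (k := k) n x
      cases n with
      | zero => simp
      | succ n =>
        simp only [LinearMap.comp_apply, AlgHom.toLinearMap_apply, LinearMap.neg_apply,
          sgn_of_mem h, sgn_of_mem ((leibD_hasDegNegOne L).succ n _ h), map_smul, pow_succ,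
          mul_neg, mul_one, neg_smul, map_neg, neg_neg]
  exact LinearMap.congr_fun this w

/-- This is where the Leibniz identity enters, as D_v D_u - D_u D_v = D_{uv}. On a product w·su,
both sides then satisfy the same recursion. -/
theorem leibD_deriv (v : g) (w : TensorAlgebra k g) :
    leibD L (deriv (L.mul.flip v) w) = deriv (L.mul.flip v) (leibD L w) := by
  have : leibD L ∘ₗ deriv (L.mul.flip v) = deriv (L.mul.flip v) ∘ₗ leibD L :=
    ext_mul_ι (by simp) fun w u h => by
      simp only [LinearMap.comp_apply] at h ⊢
      have hc := deriv_comm (L.mul.flip v) (L.mul.flip u) (sgn k g w)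
      have hu : L.mul.flip v ∘ₗ L.mul.flip u - L.mul.flip u ∘ₗ L.mul.flip v =
          L.mul.flip (L.mul u v) := by
        ext z
        simp [L.leibniz]
      rw [hu] at hc
      simp only [deriv_mul, deriv_ι, map_add, leibD_mul_ι, h, sgn_deriv, hc, LinearMap.flip_apply]
      abel
  exact LinearMap.congr_fun this w

/-- Applying the recursion twice to w·sv leaves D_v(sgn dw) + d D_v(sgn w), which cancels because d
commutes with D_v and anticommutes with sgn. -/
theorem leibD_comp_leibD : leibD L ∘ₗ leibD L = 0 :=
  ext_mul_ι (by simp) fun w v h => by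
    simp only [LinearMap.comp_apply, LinearMap.zero_apply] at h ⊢
    rw [leibD_mul_ι, map_add, leibD_mul_ι, h, leibD_deriv, sgn_leibD]
    simp

end Differential

end LeibnizComplex

namespace LeibnizComplex

/-! ### Homogeneous subspaces of T(sg) -/

section Homogeneous

variable {k : Type*} [Field k] {g : Type*} [AddCommGroup g] [Module k g]

theorem decompose_mem_of_mem {F : Submodule k (TensorAlgebra k g)} {x : TensorAlgebra k g} {j : ℕ}
    (hx : x ∈ F) (hj : x ∈ grading k g j) (i : ℕ) :
    (DirectSum.decompose (grading k g) x i : TensorAlgebra k g) ∈ F := by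
  by_cases h : j = i
  · subst h; rwa [DirectSum.decompose_of_mem_same _ hj]
  · rw [DirectSum.decompose_of_mem_ne _ hj h]; exact F.zero_mem

theorem isHomogeneous_of_le_span {F : Submodule k (TensorAlgebra k g)}
    {S : Set (TensorAlgebra k g)} (hS : S ⊆ F) (hF : F ≤ Submodule.span k S)
    (h : ∀ x ∈ S, ∃ i, x ∈ grading k g i) : F.IsHomogeneous (grading k g) := by
  intro i x hx
  replace hx := hF hx
  induction hx using Submodule.span_induction with
  | mem x hx => obtain ⟨j, hj⟩ := h x hx; exact decompose_mem_of_mem (hS hx) hj i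
  | zero => simp
  | add x y _ _ hx hy => rw [DirectSum.decompose_add]; exact Submodule.add_mem _ hx hy
  | smul a x _ hx => rw [DirectSum.decompose_smul]; exact Submodule.smul_mem _ a hx

theorem le_span_homogeneous {F : Submodule k (TensorAlgebra k g)}
    (hF : F.IsHomogeneous (grading k g)) :
    F ≤ Submodule.span k {x | x ∈ F ∧ ∃ i, x ∈ grading k g i} := by
  classical
  intro x hx
  rw [← DirectSum.sum_support_decompose (grading k g) x]
  exact Submodule.sum_mem _ fun i _ => Submodule.subset_span ⟨hF i hx, i, Subtype.mem _⟩

open scoped Pointwise in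
theorem isHomogeneous_mul {F G : Submodule k (TensorAlgebra k g)}
    (hF : F.IsHomogeneous (grading k g)) (hG : G.IsHomogeneous (grading k g)) :
    (F * G).IsHomogeneous (grading k g) := by
  refine isHomogeneous_of_le_span
    (S := {x | x ∈ F ∧ ∃ i, x ∈ grading k g i} * {x | x ∈ G ∧ ∃ i, x ∈ grading k g i}) ?_ ?_ ?_
  · rintro _ ⟨x, hx, y, hy, rfl⟩
    exact Submodule.mul_mem_mul hx.1 hy.1
  · rw [← Submodule.span_mul_span]
    exact mul_le_mul' (le_span_homogeneous hF) (le_span_homogeneous hG)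
  · rintro _ ⟨x, ⟨_, i, hx⟩, y, ⟨_, j, hy⟩, rfl⟩
    exact ⟨i + j, mul_mem_grading hx hy⟩

theorem isHomogeneous_sup {F G : Submodule k (TensorAlgebra k g)}
    (hF : F.IsHomogeneous (grading k g)) (hG : G.IsHomogeneous (grading k g)) :
    (F ⊔ G).IsHomogeneous (grading k g) := by
  intro i x hx
  obtain ⟨a, ha, b, hb, rfl⟩ := Submodule.mem_sup.1 hx
  rw [DirectSum.decompose_add]
  exact Submodule.add_mem_sup (hF i ha) (hG i hb)

theorem isHomogeneous_one :
    (1 : Submodule k (TensorAlgebra k g)).IsHomogeneous (grading k g) := by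
  intro i x hx
  exact decompose_mem_of_mem hx (by rwa [grading, pow_zero] : x ∈ grading k g 0) i

theorem sgn_mem {F : Submodule k (TensorAlgebra k g)} (hF : F.IsHomogeneous (grading k g))
    {x : TensorAlgebra k g} (hx : x ∈ F) : sgn k g x ∈ F := by
  replace hx := le_span_homogeneous hF hx
  induction hx using Submodule.span_induction with
  | mem x hx =>
    obtain ⟨hx, i, hi⟩ := hx
    rw [sgn_of_mem hi]
    exact F.smul_mem _ hx
  | zero => simp
  | add x y _ _ hx hy => rw [map_add]; exact Submodule.add_mem _ hx hy
  | smul a x _ hx => rw [map_smul]; exact Submodule.smul_mem _ a hx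

end Homogeneous

/-! ### Stability of Lie(sg) under the differential -/

section Lie

variable {k : Type*} [Field k] {g : Type*} [AddCommGroup g] [Module k g]

/-- The graded commutator carries a sign depending on degrees, so it extends bilinearly only within
fixed degrees. Taking the part of degree m of a combination of monomials keeps exactly those of
weight m. -/
theorem mem_span_monomial {m : ℕ} {X : TensorAlgebra k g} (hX : X ∈ lie k g)
    (hm : X ∈ grading k g m) : X ∈ Submodule.span k {X | IsLieMonomial (k := k) (g := g) m X} := by
  rw [← DirectSum.decompose_of_mem_same _ hm]
  clear hm
  induction hX using Submodule.span_induction with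
  | mem X h =>
    obtain ⟨n, hn⟩ := h
    by_cases hi : n = m
    · subst hi
      rw [DirectSum.decompose_of_mem_same _ hn.mem_grading]
      exact Submodule.subset_span hn
    · rw [DirectSum.decompose_of_mem_ne _ hn.mem_grading hi]
      exact Submodule.zero_mem _
  | zero => simp
  | add x y _ _ hx hy => rw [DirectSum.decompose_add]; exact Submodule.add_mem _ hx hy
  | smul a x _ hx => rw [DirectSum.decompose_smul]; exact Submodule.smul_mem _ a hx

theorem lie_bracket_mem {m n : ℕ} {X Y : TensorAlgebra k g} (hX : X ∈ lie k g)
    (hm : X ∈ grading k g m) (hY : Y ∈ lie k g) (hn : Y ∈ grading k g n) :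
    X * Y - (-1 : k) ^ (m * n) • (Y * X) ∈ lie k g := by
  replace hX := mem_span_monomial hX hm
  replace hY := mem_span_monomial hY hn
  clear hm hn
  induction hX, hY using Submodule.span_induction₂ with
  | mem_mem x y hx hy => exact Submodule.subset_span ⟨_, hx.bracket hy⟩
  | zero_left y _ => simp
  | zero_right x _ => simp
  | add_left x y z _ _ _ h1 h2 =>
    convert! Submodule.add_mem _ h1 h2 using 1
    rw [add_mul, mul_add, smul_add]; abel
  | add_right x y z _ _ _ h1 h2 =>
    convert! Submodule.add_mem _ h1 h2 using 1
    rw [add_mul, mul_add, smul_add]; abel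
  | smul_left r x y _ _ h =>
    convert! Submodule.smul_mem _ r h using 1
    rw [smul_mul_assoc, mul_smul_comm, smul_sub, smul_comm]
  | smul_right r x y _ _ h =>
    convert! Submodule.smul_mem _ r h using 1
    rw [smul_mul_assoc, mul_smul_comm, smul_sub, smul_comm]

/-- The derivation preserves degree, so it satisfies the product rule for the graded commutator with
unchanged signs. -/
theorem deriv_mem_lie (φ : g →ₗ[k] g) {X : TensorAlgebra k g} (hX : X ∈ lie k g) :
    deriv φ X ∈ lie k g := by
  induction hX using Submodule.span_induction with
  | mem X h =>
    obtain ⟨n, hn⟩ := h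
    induction hn with
    | gen x => rw [deriv_ι]; exact Submodule.subset_span ⟨1, .gen _⟩
    | @bracket m n X Y hX hY h1 h2 =>
      have e1 := lie_bracket_mem h1 (deriv_mem_grading φ hX.mem_grading)
        (Submodule.subset_span ⟨n, hY⟩) hY.mem_grading
      have e2 := lie_bracket_mem (Submodule.subset_span ⟨m, hX⟩) hX.mem_grading h2
        (deriv_mem_grading φ hY.mem_grading)
      convert! Submodule.add_mem _ e1 e2 using 1
      simp only [map_sub, map_smul, deriv_mul, smul_add]
      abel
  | zero => simp
  | add x y _ _ hx hy => rw [map_add]; exact Submodule.add_mem _ hx hy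
  | smul a x _ hx => rw [map_smul]; exact Submodule.smul_mem _ a hx

variable (L : LeibnizAlgebra k g)

/-- A generator has a correction term by `leibD_mul_ι`. For a bracket, expanding d(wXY) and d(wYX)
yields D_y(sgn w)X and D_x(sgn w)Y twice each, and they cancel. The signs match only when the factor
carrying a nonzero correction has weight one, which is why `m = 1 ∨ x = 0` is carried through the
induction. -/
theorem IsLieMonomial.leibD_mul {m : ℕ} {X : TensorAlgebra k g} (hX : IsLieMonomial m X) :
    ∃ x : g, (m = 1 ∨ x = 0) ∧ ∀ w, leibD L (w * X) =
      leibD L w * X + sgn k g w * leibD L X + deriv (L.mul.flip x) (sgn k g w) := by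
  induction hX with
  | gen x => exact ⟨x, Or.inl rfl, fun w => by rw [leibD_mul_ι, leibD_ι, mul_zero, add_zero]⟩
  | @bracket m n X Y hX hY h1 h2 =>
    obtain ⟨x, hx, h1⟩ := h1
    obtain ⟨y, hy, h2⟩ := h2
    refine ⟨0, Or.inr rfl, fun w => ?_⟩
    have sX := sgn_of_mem hX.mem_grading
    have sY := sgn_of_mem hY.mem_grading
    -- For m = 1 the exponent is 2n; otherwise x = 0 and the derivation vanishes.
    have eX : (-1 : k) ^ (m * n + n) • deriv (L.mul.flip x) (sgn k g w) =
        deriv (L.mul.flip x) (sgn k g w) := by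
      rcases hx with rfl | rfl
      · simp [← two_mul]
      · simp
    have eY : (-1 : k) ^ (m * n + m) • deriv (L.mul.flip y) (sgn k g w) =
        deriv (L.mul.flip y) (sgn k g w) := by
      rcases hy with rfl | rfl
      · simp [← two_mul]
      · simp
    have hsq : (-1 : k) ^ m * (-1) ^ m = 1 := by rw [← mul_pow]; simp
    have key : (-1 : k) ^ m • (deriv (L.mul.flip y) (sgn k g w) * X) =
        (-1 : k) ^ (m * n) • (deriv (L.mul.flip y) (sgn k g w) * X) := by
      have h : (-1 : k) ^ (m * n) = (-1) ^ m * (-1) ^ (m * n + m) := by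
        rw [pow_add, mul_left_comm, hsq, mul_one]
      rw [h, mul_smul, ← smul_mul_assoc ((-1 : k) ^ (m * n + m)), eY]
    have key' : (-1 : k) ^ (m * n) • (-1 : k) ^ n • (deriv (L.mul.flip x) (sgn k g w) * Y) =
        deriv (L.mul.flip x) (sgn k g w) * Y := by
      rw [smul_smul, ← pow_add, ← smul_mul_assoc, eX]
    simp only [mul_sub, mul_smul_comm, map_sub, map_smul, ← mul_assoc, h1, h2, map_mul, sX, sY,
      deriv_mul, add_mul, mul_add, smul_add, smul_mul_assoc, key, key', map_zero, deriv_zero]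
    abel

theorem leibD_mul_of_mem_lie {X : TensorAlgebra k g} (hX : X ∈ lie k g) :
    ∃ x : g, ∀ w, leibD L (w * X) =
      leibD L w * X + sgn k g w * leibD L X + deriv (L.mul.flip x) (sgn k g w) := by
  induction hX using Submodule.span_induction with
  | mem X h =>
    obtain ⟨n, hn⟩ := h
    obtain ⟨x, -, hx⟩ := hn.leibD_mul L
    exact ⟨x, hx⟩
  | zero => exact ⟨0, fun w => by simp⟩
  | add X Y _ _ hX hY =>
    obtain ⟨x, hx⟩ := hX
    obtain ⟨y, hy⟩ := hY
    refine ⟨x + y, fun w => ?_⟩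
    simp only [mul_add, map_add, hx, hy, deriv_add]
    abel
  | smul a X _ hX =>
    obtain ⟨x, hx⟩ := hX
    refine ⟨a • x, fun w => ?_⟩
    simp only [mul_smul_comm, map_smul, hx, deriv_smul, smul_add]

/-- For a bracket, the recursion with w = X and with w = Y writes d[X, Y] as a combination of [dX,
Y], [X, dY], D_y X and D_x Y. -/
theorem leibD_mem_lie {X : TensorAlgebra k g} (hX : X ∈ lie k g) : leibD L X ∈ lie k g := by
  induction hX using Submodule.span_induction with
  | mem X h =>
    obtain ⟨n, hn⟩ := h
    induction hn with
    | gen x => simp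
    | @bracket m n X Y hX hY h1 h2 =>
      obtain ⟨x, -, hx⟩ := hX.leibD_mul L
      obtain ⟨y, -, hy⟩ := hY.leibD_mul L
      have lX : X ∈ lie k g := Submodule.subset_span ⟨m, hX⟩
      have lY : Y ∈ lie k g := Submodule.subset_span ⟨n, hY⟩
      -- The commutator of dX and Y has sign exponent (m - 1)n, of the same parity as mn + n. If m =
      -- 0 then dX = 0.
      have e1 : leibD L X * Y - (-1 : k) ^ (m * n + n) • (Y * leibD L X) ∈ lie k g := by
        cases m with
        | zero => simp [(leibD_hasDegNegOne L).zero _ hX.mem_grading]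
        | succ m =>
          have := lie_bracket_mem h1 ((leibD_hasDegNegOne L).succ _ _ hX.mem_grading) lY
            hY.mem_grading
          convert! this using 3
          rw [show (m + 1) * n + n = m * n + 2 * n by ring, pow_add]
          simp
      have e2 : (-1 : k) ^ m • (X * leibD L Y) - (-1 : k) ^ (m * n) • (leibD L Y * X) ∈
          lie k g := by
        cases n with
        | zero => simp [(leibD_hasDegNegOne L).zero _ hY.mem_grading]
        | succ n =>
          have := Submodule.smul_mem _ ((-1 : k) ^ m) <| lie_bracket_mem lX hX.mem_grading h2
            ((leibD_hasDegNegOne L).succ _ _ hY.mem_grading)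
          rw [smul_sub, smul_smul, ← pow_add] at this
          convert! this using 4
          ring
      have e3 := Submodule.smul_mem _ ((-1 : k) ^ m) (deriv_mem_lie (L.mul.flip y) lX)
      have e4 := Submodule.smul_mem _ ((-1 : k) ^ (m * n + n)) (deriv_mem_lie (L.mul.flip x) lY)
      convert! Submodule.sub_mem _ (Submodule.add_mem _ (Submodule.add_mem _ e1 e2) e3) e4 using 1
      rw [map_sub, map_smul, hx, hy, sgn_of_mem hX.mem_grading, sgn_of_mem hY.mem_grading]
      simp only [smul_add, map_smul, smul_mul_assoc, smul_smul, ← pow_add]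
      abel
  | zero => simp
  | add x y _ _ hx hy => rw [map_add]; exact Submodule.add_mem _ hx hy
  | smul a x _ hx => rw [map_smul]; exact Submodule.smul_mem _ a hx

theorem lie_isSubcomplex : IsSubcomplex L (lie k g) :=
  ⟨lie_isHomogeneous k g, fun _ => leibD_mem_lie L⟩

end Lie

/-! ### The primitive filtration: multiplicativity, exhaustion, stability -/

section Filtration

variable (k : Type*) [Field k] (g : Type*) [AddCommGroup g] [Module k g]

theorem fil_eq_iSup (n : ℕ) : fil k g n = ⨆ (i : ℕ) (_ : i ≤ n), lie k g ^ i := by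
  simp only [fil, Submodule.map_iSup]
  refine iSup_congr fun i => iSup_congr fun _ => ?_
  rw [grading, Submodule.map_pow]
  congr 1
  ext x
  simp

/-- Padding with factors 1 absorbs the shorter products. As powers of one subspace, the f_n are
visibly multiplicative and satisfy one-step recursions from either side. -/
theorem fil_eq_pow (n : ℕ) : fil k g n = (1 ⊔ lie k g) ^ n := by
  rw [fil_eq_iSup]
  apply le_antisymm
  · exact iSup₂_le fun i hi => (pow_le_pow_left' le_sup_right i).trans
      (pow_le_pow_right' le_sup_left hi)
  · induction n with
    | zero => rw [pow_zero]; exact le_iSup₂_of_le 0 le_rfl (by rw [pow_zero])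
    | succ n ih =>
      rw [pow_succ, Submodule.mul_sup, mul_one]
      refine sup_le (ih.trans ?_) ((mul_le_mul' ih le_rfl).trans ?_)
      · exact iSup₂_le fun i hi => le_iSup₂_of_le i (hi.trans n.le_succ) le_rfl
      · rw [Submodule.iSup_mul]
        refine iSup_le fun i => ?_
        rw [Submodule.iSup_mul]
        refine iSup_le fun hi => ?_
        rw [← pow_succ]
        exact le_iSup₂_of_le (i + 1) (by lia) le_rfl

theorem fil_zero : fil k g 0 = 1 := by rw [fil_eq_pow, pow_zero]

theorem fil_succ (n : ℕ) : fil k g (n + 1) = fil k g n ⊔ fil k g n * lie k g := by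
  rw [fil_eq_pow, fil_eq_pow, pow_succ, Submodule.mul_sup, mul_one]

theorem fil_succ' (n : ℕ) : fil k g (n + 1) = fil k g n ⊔ lie k g * fil k g n := by
  rw [fil_eq_pow, fil_eq_pow, pow_succ', Submodule.sup_mul, one_mul]

theorem fil_le_succ (n : ℕ) : fil k g n ≤ fil k g (n + 1) := by
  rw [fil_succ]; exact le_sup_left

theorem fil_mono : Monotone (fil k g) := monotone_nat_of_le_succ (fil_le_succ k g)

/-- Generators lie in Lie(sg), so tensors of length n are already in f_n. -/
theorem iSup_fil : ⨆ n : ℕ, fil k g n = ⊤ := by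
  rw [eq_top_iff, ← (DirectSum.Decomposition.isInternal (grading k g)).submodule_iSup_eq_top]
  refine iSup_mono fun n => ?_
  rw [fil_eq_pow]
  refine pow_le_pow_left' (le_trans ?_ le_sup_right) n
  rintro _ ⟨x, rfl⟩
  exact Submodule.subset_span ⟨1, .gen x⟩

theorem fil_isHomogeneous (n : ℕ) : (fil k g n).IsHomogeneous (grading k g) := by
  induction n with
  | zero => rw [fil_zero]; exact isHomogeneous_one
  | succ n ih =>
    rw [fil_succ]
    exact isHomogeneous_sup ih (isHomogeneous_mul ih (lie_isHomogeneous k g))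

variable {k g}

theorem one_mem_fil (n : ℕ) : (1 : TensorAlgebra k g) ∈ fil k g n :=
  fil_mono k g n.zero_le (by rw [fil_zero]; exact Submodule.one_le.1 le_rfl)

theorem mul_mem_fil {m n : ℕ} {a b : TensorAlgebra k g} (ha : a ∈ fil k g m)
    (hb : b ∈ fil k g n) : a * b ∈ fil k g (m + n) := by
  rw [fil_eq_pow] at *
  rw [pow_add]
  exact Submodule.mul_mem_mul ha hb

theorem mem_fil_one {X : TensorAlgebra k g} (hX : X ∈ lie k g) : X ∈ fil k g 1 := by
  rw [fil_eq_pow, pow_one]; exact Submodule.mem_sup_right hX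

theorem lie_mul_mem_fil {n : ℕ} {X w : TensorAlgebra k g} (hX : X ∈ lie k g)
    (hw : w ∈ fil k g n) : X * w ∈ fil k g (n + 1) := by
  rw [add_comm]; exact mul_mem_fil (mem_fil_one hX) hw

theorem mul_lie_mem_fil {n : ℕ} {X w : TensorAlgebra k g} (hX : X ∈ lie k g)
    (hw : w ∈ fil k g n) : w * X ∈ fil k g (n + 1) := mul_mem_fil hw (mem_fil_one hX)

theorem lie_mul_mem_fil_of_filPred {n : ℕ} {X w : TensorAlgebra k g} (hX : X ∈ lie k g)
    (hw : w ∈ filPred k g n) : X * w ∈ fil k g n := by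
  cases n with
  | zero => rw [(Submodule.mem_bot k).1 hw]; simp
  | succ n => exact lie_mul_mem_fil hX hw

theorem mul_lie_mem_fil_of_filPred {n : ℕ} {X w : TensorAlgebra k g} (hX : X ∈ lie k g)
    (hw : w ∈ filPred k g n) : w * X ∈ fil k g n := by
  cases n with
  | zero => rw [(Submodule.mem_bot k).1 hw]; simp
  | succ n => exact mul_lie_mem_fil hX hw

theorem filPred_isHomogeneous (n : ℕ) : (filPred k g n).IsHomogeneous (grading k g) := by
  cases n with
  | zero => intro i x hx; rw [(Submodule.mem_bot k).1 hx]; simp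
  | succ n => exact fil_isHomogeneous k g n

theorem fil_succ_induction {n : ℕ} {C : TensorAlgebra k g → Prop}
    (fil : ∀ w ∈ fil k g n, C w) (mul : ∀ w ∈ LeibnizComplex.fil k g n, ∀ X ∈ lie k g, C (w * X))
    (add : ∀ a b, C a → C b → C (a + b)) {w : TensorAlgebra k g}
    (hw : w ∈ LeibnizComplex.fil k g (n + 1)) : C w := by
  rw [fil_succ] at hw
  obtain ⟨a, ha, b, hb, rfl⟩ := Submodule.mem_sup.1 hw
  refine add _ _ (fil a ha) ?_
  clear hw
  induction hb using Submodule.mul_induction_on' with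
  | mem_mul_mem w hw X hX => exact mul w hw X hX
  | add a _ b _ ha hb => exact add _ _ ha hb

theorem deriv_mem_fil (φ : g →ₗ[k] g) {n : ℕ} {w : TensorAlgebra k g} (hw : w ∈ fil k g n) :
    deriv φ w ∈ fil k g n := by
  induction n generalizing w with
  | zero =>
    rw [fil_zero, Submodule.mem_one] at hw
    obtain ⟨c, rfl⟩ := hw
    rw [Algebra.algebraMap_eq_smul_one, map_smul, deriv_one, smul_zero]
    exact Submodule.zero_mem _
  | succ n ih =>
    refine fil_succ_induction (fun w hw => fil_le_succ k g n (ih hw)) (fun w hw X hX => ?_)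
      (fun a b ha hb => ?_) hw
    · rw [deriv_mul]
      exact Submodule.add_mem _ (mul_lie_mem_fil hX (ih hw))
        (mul_lie_mem_fil (deriv_mem_lie φ hX) hw)
    · rw [map_add]; exact Submodule.add_mem _ ha hb

/-- For wX with w in f_n and X in Lie(sg), the first two terms of d(wX) end in a Lie factor and lie
in f_{n+1}; the correction D_x(sgn w) even stays in f_n. -/
theorem leibD_mem_fil (L : LeibnizAlgebra k g) {n : ℕ} {w : TensorAlgebra k g}
    (hw : w ∈ fil k g n) : leibD L w ∈ fil k g n := by
  induction n generalizing w with
  | zero =>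
    rw [fil_zero, Submodule.mem_one] at hw
    obtain ⟨c, rfl⟩ := hw
    rw [Algebra.algebraMap_eq_smul_one, map_smul, leibD_one, smul_zero]
    exact Submodule.zero_mem _
  | succ n ih =>
    refine fil_succ_induction (fun w hw => fil_le_succ k g n (ih hw)) (fun w hw X hX => ?_)
      (fun a b ha hb => ?_) hw
    · obtain ⟨x, hx⟩ := leibD_mul_of_mem_lie L hX
      have hs := sgn_mem (fil_isHomogeneous k g n) hw
      rw [hx]
      exact Submodule.add_mem _ (Submodule.add_mem _ (mul_lie_mem_fil hX (ih hw))
        (mul_lie_mem_fil (leibD_mem_lie L hX) hs)) (fil_le_succ k g n (deriv_mem_fil _ hs))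
    · rw [map_add]; exact Submodule.add_mem _ ha hb

theorem fil_isSubcomplex (L : LeibnizAlgebra k g) (n : ℕ) : IsSubcomplex L (fil k g n) :=
  ⟨fil_isHomogeneous k g n, fun _ => leibD_mem_fil L⟩

end Filtration

end LeibnizComplex

namespace LeibnizComplex

/-! ### The coproduct, the counit and primitivity of Lie elements -/

section Coproduct

variable {k : Type*} [Field k] {g : Type*} [AddCommGroup g] [Module k g]

open GradedTensorProduct in
/-- The linear map on `T(s g) ⊗ T(s g)` given by a bilinear map. -/
noncomputable def gradedLift {U : Type*} [AddCommGroup U] [Module k U]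
    (B : TensorAlgebra k g →ₗ[k] TensorAlgebra k g →ₗ[k] U) :
    (grading k g ᵍ⊗[k] grading k g) →ₗ[k] U :=
  TensorProduct.lift B ∘ₗ (of k (grading k g) (grading k g)).symm.toLinearMap

@[simp] theorem gradedLift_tmul {U : Type*} [AddCommGroup U] [Module k U]
    (B : TensorAlgebra k g →ₗ[k] TensorAlgebra k g →ₗ[k] U) (a b : TensorAlgebra k g) :
    gradedLift B (a ᵍ⊗ₜ[k] b : grading k g ᵍ⊗[k] grading k g) = B a b := rfl

variable (k g) in
/-- The map `X ↦ X ⊗ 1 + 1 ⊗ X`. -/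
noncomputable def primMap : TensorAlgebra k g →ₗ[k] (grading k g ᵍ⊗[k] grading k g) :=
  (GradedTensorProduct.includeLeft (grading k g) (grading k g)).toLinearMap +
    (GradedTensorProduct.includeRight (grading k g) (grading k g)).toLinearMap

theorem primMap_apply (X : TensorAlgebra k g) :
    primMap k g X = X ᵍ⊗ₜ[k] (1 : TensorAlgebra k g) + (1 : TensorAlgebra k g) ᵍ⊗ₜ[k] X := rfl

theorem mem_primitives {X : TensorAlgebra k g} :
    X ∈ primitives k g ↔ coproduct k g X = primMap k g X := Iff.rfl

theorem coproduct_ι (x : g) :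
    coproduct k g (TensorAlgebra.ι k x) = primMap k g (TensorAlgebra.ι k x) := by
  simp [coproduct, primMap]

theorem primMap_mul_tmul {p i : ℕ} {X a : TensorAlgebra k g} (hX : X ∈ grading k g p)
    (ha : a ∈ grading k g i) (b : TensorAlgebra k g) :
    primMap k g X * (a ᵍ⊗ₜ[k] b : grading k g ᵍ⊗[k] grading k g) =
      ((X * a) ᵍ⊗ₜ[k] b : grading k g ᵍ⊗[k] grading k g) +
        (-1 : k) ^ (p * i) • (a ᵍ⊗ₜ[k] (X * b)) := by
  rw [primMap_apply, add_mul]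
  congr 1
  · exact GradedTensorProduct.tmul_one_mul_coe_tmul (grading k g) (grading k g) X ⟨a, ha⟩ b
  · have := GradedTensorProduct.tmul_coe_mul_coe_tmul (R := k) (grading k g) (grading k g) 1
      ⟨X, hX⟩ ⟨a, ha⟩ b
    rw [this, one_mul]
    -- The parity split turns the sign of the graded tensor product into a power of -1 in k.
    rcases Nat.even_or_odd (p * i) with h | h
    · simp [h.neg_one_pow]
    · simp [h.neg_one_pow]

theorem gradedTensor_ext {U : Type*} [AddCommGroup U] [Module k U]
    {f h : (grading k g ᵍ⊗[k] grading k g) →ₗ[k] U}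
    (H : ∀ i, ∀ a ∈ grading k g i, ∀ b, f (a ᵍ⊗ₜ[k] b) = h (a ᵍ⊗ₜ[k] b)) : f = h := by
  refine GradedTensorProduct.hom_ext _ _ ?_
  refine TensorProduct.ext (ext_tprod fun n x => ?_)
  exact LinearMap.ext fun b => H n _ (tprod_mem_grading n x) b

/-- In the graded commutator of two primitives the mixed terms X ⊗ Y and Y ⊗ X cancel, thanks to the
Koszul signs. -/
theorem lie_le_primitives : lie k g ≤ primitives k g := by
  refine Submodule.span_le.2 ?_
  rintro X ⟨n, hn⟩
  change X ∈ primitives k g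
  rw [mem_primitives]
  induction hn with
  | gen x => exact coproduct_ι x
  | @bracket m n X Y hX hY h1 h2 =>
    have hX := hX.mem_grading
    have hY := hY.mem_grading
    have h := primMap_mul_tmul hX hY 1
    have h' := primMap_mul_tmul hX one_mem_grading Y
    have l := primMap_mul_tmul hY hX 1
    have l' := primMap_mul_tmul hY one_mem_grading X
    have hsq : (-1 : k) ^ (m * n) * (-1) ^ (m * n) = 1 := by rw [← mul_pow]; simp
    have e := congrArg (primMap k g X * ·) (primMap_apply Y)
    have e' := congrArg (primMap k g Y * ·) (primMap_apply X)
    simp only [mul_add, h, h', l, l'] at e e'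
    rw [map_sub, map_smul, map_mul, map_mul, h1, h2, e, e', map_sub, map_smul, primMap_apply,
      primMap_apply]
    simp only [mul_one, mul_zero, pow_zero, one_smul, mul_comm n m, smul_add, smul_smul, hsq]
    abel

/-- The augmentation of `T(s g)`. -/
noncomputable abbrev aug : TensorAlgebra k g →ₐ[k] k := TensorAlgebra.algebraMapInv

@[simp] theorem aug_ι (x : g) : aug (TensorAlgebra.ι k x) = 0 := by
  simp [aug, TensorAlgebra.algebraMapInv]

theorem aug_of_mem {n : ℕ} {w : TensorAlgebra k g} (hw : w ∈ grading k g (n + 1)) :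
    aug w = 0 := by
  rw [grading_eq_span] at hw
  induction hw using Submodule.span_induction with
  | mem w h =>
    obtain ⟨x, rfl⟩ := h
    rw [← Fin.cons_self_tail x, tprod_cons, map_mul, aug_ι, zero_mul]
  | zero => simp
  | add a b _ _ ha hb => rw [map_add, ha, hb, add_zero]
  | smul c a _ ha => rw [map_smul, ha, smul_zero]

theorem eq_aug_of_mem {w : TensorAlgebra k g} (hw : w ∈ grading k g 0) :
    w = algebraMap k _ (aug w) := by
  rw [grading, pow_zero, Submodule.mem_one] at hw
  obtain ⟨c, rfl⟩ := hw
  simp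

theorem decompose_zero_eq (w : TensorAlgebra k g) :
    (DirectSum.decompose (grading k g) w 0 : TensorAlgebra k g) = algebraMap k _ (aug w) := by
  induction w using DirectSum.Decomposition.inductionOn (grading k g) with
  | zero => simp
  | @homogeneous i m =>
    obtain ⟨m, hm⟩ := m
    cases i with
    | zero => rw [DirectSum.decompose_of_mem_same _ hm]; exact eq_aug_of_mem hm
    | succ i =>
      rw [DirectSum.decompose_of_mem_ne _ hm (Nat.succ_ne_zero i)]
      simp [aug_of_mem hm]
  | add a b ha hb => rw [DirectSum.decompose_add, map_add, map_add, ← ha, ← hb]; rfl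

/-- The counit, applied to the left factor. -/
noncomputable def augLeft : (grading k g ᵍ⊗[k] grading k g) →ₗ[k] TensorAlgebra k g :=
  gradedLift ((LinearMap.lsmul k (TensorAlgebra k g)) ∘ₗ aug.toLinearMap)

@[simp] theorem augLeft_tmul (a b : TensorAlgebra k g) :
    augLeft (a ᵍ⊗ₜ[k] b : grading k g ᵍ⊗[k] grading k g) = aug a • b := rfl

/-- The counit axiom: left multiplication of Δ(w) by v ⊗ 1 + 1 ⊗ v becomes multiplication by v,
since the counit kills va. -/
theorem augLeft_coproduct (w : TensorAlgebra k g) : augLeft (coproduct k g w) = w := by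
  have : augLeft ∘ₗ (coproduct k g).toLinearMap = LinearMap.id := by
    refine ext_ι_mul ?_ fun w v h => ?_
    · simp only [LinearMap.comp_apply, AlgHom.toLinearMap_apply, map_one, LinearMap.id_apply]
      exact (augLeft_tmul 1 1).trans (by simp)
    · simp only [LinearMap.comp_apply, AlgHom.toLinearMap_apply, LinearMap.id_apply] at h ⊢
      rw [map_mul, coproduct_ι]
      conv_rhs => rw [← h]
      generalize coproduct k g w = t
      have : augLeft ∘ₗ LinearMap.mulLeft k (primMap k g (TensorAlgebra.ι k v)) =
          LinearMap.mulLeft k (TensorAlgebra.ι k v) ∘ₗ augLeft := by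
        refine gradedTensor_ext fun i a ha b => ?_
        simp only [LinearMap.comp_apply, LinearMap.mulLeft_apply,
          primMap_mul_tmul (ι_mem_grading v) ha, map_add, map_smul, augLeft_tmul, map_mul, aug_ι]
        -- The Koszul sign is 1 for i = 0, and for i > 0 the counit of a vanishes.
        cases i with
        | zero => simp
        | succ i => simp [aug_of_mem ha]
      exact LinearMap.congr_fun this t
  exact LinearMap.congr_fun this w

/-- Applying the counit to X ⊗ 1 + 1 ⊗ X gives X = ε(X)1 + X. -/
theorem aug_of_mem_primitives {X : TensorAlgebra k g} (hX : X ∈ primitives k g) : aug X = 0 := by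
  have h := augLeft_coproduct X
  rw [mem_primitives.1 hX, primMap_apply, map_add, augLeft_tmul, augLeft_tmul, map_one, one_smul,
    add_eq_right, ← Algebra.algebraMap_eq_smul_one] at h
  simpa using h

end Coproduct

/-! ### The Dynkin operator, and Lie elements as primitives -/

section Dynkin

variable {k : Type*} [Field k] {g : Type*} [AddCommGroup g] [Module k g]

/-- The action of a generator `x` that defines the Dynkin operator `r`: it sends `(r w, w)` to
`(r (x w), x w)`. -/
noncomputable def dynkinStep :
    g →ₗ[k] Module.End k (TensorAlgebra k g × TensorAlgebra k g) where
  toFun x := LinearMap.prod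
    (LinearMap.mulLeft k (TensorAlgebra.ι k x) ∘ₗ LinearMap.fst k _ _ -
      LinearMap.mulRight k (TensorAlgebra.ι k x) ∘ₗ (sgn k g).toLinearMap ∘ₗ LinearMap.fst k _ _ +
      aug.toLinearMap.smulRight (TensorAlgebra.ι k x) ∘ₗ LinearMap.snd k _ _)
    (LinearMap.mulLeft k (TensorAlgebra.ι k x) ∘ₗ LinearMap.snd k _ _)
  map_add' x y := by
    refine LinearMap.ext fun p => Prod.ext ?_ ?_
    · simp [add_mul, mul_add]; abel
    · simp [add_mul]
  map_smul' c x := by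
    refine LinearMap.ext fun p => Prod.ext ?_ ?_
    · simp [smul_add, smul_sub, smul_comm c]
    · simp

theorem dynkinStep_apply (x : g) (p : TensorAlgebra k g × TensorAlgebra k g) :
    dynkinStep x p = (TensorAlgebra.ι k x * p.1 - sgn k g p.1 * TensorAlgebra.ι k x +
      aug p.2 • TensorAlgebra.ι k x, TensorAlgebra.ι k x * p.2) := rfl

/-- The Dynkin operator: `x₁ ⊗ ⋯ ⊗ xₙ ↦ [x₁, [x₂, ⋯ xₙ]]`. -/
noncomputable def dynkin : TensorAlgebra k g →ₗ[k] TensorAlgebra k g :=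
  LinearMap.fst k (TensorAlgebra k g) (TensorAlgebra k g) ∘ₗ
    LinearMap.applyₗ ((0, 1) : TensorAlgebra k g × TensorAlgebra k g) ∘ₗ
      (TensorAlgebra.lift k (dynkinStep (k := k) (g := g))).toLinearMap

theorem snd_lift_dynkinStep (w : TensorAlgebra k g) :
    (TensorAlgebra.lift k dynkinStep w (0, 1)).2 = w := by
  have : LinearMap.snd k (TensorAlgebra k g) (TensorAlgebra k g) ∘ₗ
      LinearMap.applyₗ ((0, 1) : TensorAlgebra k g × TensorAlgebra k g) ∘ₗ
      (TensorAlgebra.lift k (dynkinStep (k := k) (g := g))).toLinearMap = LinearMap.id := by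
    refine ext_ι_mul (by simp) fun w v h => ?_
    simp only [LinearMap.comp_apply, LinearMap.applyₗ_apply_apply, AlgHom.toLinearMap_apply,
      LinearMap.snd_apply, LinearMap.id_apply] at h ⊢
    rw [map_mul, Module.End.mul_apply, TensorAlgebra.lift_ι_apply]
    conv_rhs => rw [← h]
    rfl
  exact LinearMap.congr_fun this w

theorem dynkin_one : dynkin (1 : TensorAlgebra k g) = 0 := by
  simp [dynkin]

/-- The first two terms form the graded commutator of x with the Dynkin image of w. The augmentation
term starts the recursion, giving x ↦ x although 1 ↦ 0; it is why the defining action has to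
remember w beside its image. -/
theorem dynkin_ι_mul (x : g) (w : TensorAlgebra k g) :
    dynkin (TensorAlgebra.ι k x * w) = TensorAlgebra.ι k x * dynkin w -
      sgn k g (dynkin w) * TensorAlgebra.ι k x + aug w • TensorAlgebra.ι k x := by
  simp only [dynkin, LinearMap.comp_apply, LinearMap.applyₗ_apply_apply, AlgHom.toLinearMap_apply,
      LinearMap.fst_apply]
  rw [map_mul, Module.End.mul_apply, TensorAlgebra.lift_ι_apply, dynkinStep_apply,
    snd_lift_dynkinStep]

/-- Membership and degree go through the induction together, since closure under the graded
commutator requires known degrees. -/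
theorem dynkin_tprod_mem (n : ℕ) (x : Fin n → g) :
    dynkin (TensorAlgebra.tprod k g n x) ∈ lie k g ∧
      dynkin (TensorAlgebra.tprod k g n x) ∈ grading k g n := by
  induction n with
  | zero => simp [dynkin_one]
  | succ n ih =>
    obtain ⟨h1, h2⟩ := ih (Fin.tail x)
    have hx : TensorAlgebra.ι k (x 0) ∈ lie k g := Submodule.subset_span ⟨1, .gen _⟩
    rw [← Fin.cons_self_tail x, tprod_cons, dynkin_ι_mul, sgn_of_mem h2]
    refine ⟨Submodule.add_mem _ ?_ (Submodule.smul_mem _ _ hx), Submodule.add_mem _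
      (Submodule.sub_mem _ ?_ ?_) ?_⟩
    · have := lie_bracket_mem hx (ι_mem_grading _) h1 h2
      rwa [one_mul, ← smul_mul_assoc] at this
    · have := mul_mem_grading (ι_mem_grading (k := k) (x 0)) h2
      rwa [Nat.add_comm] at this
    · exact mul_mem_grading (Submodule.smul_mem _ _ h2) (ι_mem_grading _)
    · cases n with
      | zero => exact Submodule.smul_mem _ _ (ι_mem_grading _)
      | succ n => rw [aug_of_mem (tprod_mem_grading _ _), zero_smul]; exact Submodule.zero_mem _

theorem dynkin_mem_lie (w : TensorAlgebra k g) : dynkin w ∈ lie k g := by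
  have : (⊤ : Submodule k (TensorAlgebra k g)) ≤ (lie k g).comap dynkin := by
    rw [← span_tprod_eq_top, Submodule.span_le]
    rintro _ ⟨n, x, rfl⟩
    exact (dynkin_tprod_mem n x).1
  exact this trivial

theorem dynkin_mem_grading {n : ℕ} {w : TensorAlgebra k g} (hw : w ∈ grading k g n) :
    dynkin w ∈ grading k g n := by
  have : grading k g n ≤ (grading k g n).comap dynkin := by
    conv_lhs => rw [grading_eq_span]
    rw [Submodule.span_le]
    rintro _ ⟨x, rfl⟩
    exact (dynkin_tprod_mem n x).2
  exact this hw

/-- The convolution of the Dynkin operator with the identity is the operator which multiplies by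
the degree. -/
theorem dynkin_convolution (w : TensorAlgebra k g) :
    gradedLift (LinearMap.mul k (TensorAlgebra k g) ∘ₗ dynkin) (coproduct k g w) =
      deriv LinearMap.id w := by
  have : gradedLift (LinearMap.mul k (TensorAlgebra k g) ∘ₗ dynkin) ∘ₗ
      (coproduct k g).toLinearMap = deriv LinearMap.id := by
    refine ext_ι_mul ?_ fun w v h => ?_
    · simp only [LinearMap.comp_apply, AlgHom.toLinearMap_apply, map_one, deriv_one]
      refine (gradedLift_tmul _ 1 1).trans ?_
      simp [dynkin_one]
    · simp only [LinearMap.comp_apply, AlgHom.toLinearMap_apply] at h ⊢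
      rw [map_mul, coproduct_ι, deriv_mul, deriv_ι, LinearMap.id_apply, ← h]
      conv_rhs => enter [1, 2]; rw [← augLeft_coproduct w]
      generalize coproduct k g w = t
      -- Let r be the Dynkin operator. On a ⊗ b with a of degree i, the left side is r(va)b + (-1)^i
      -- r(a)vb; the second term cancels the -(-1)^i r(a)vb in the expansion of r(va)b, leaving
      -- v(r(a)b + ε(a)b).
      have : gradedLift (LinearMap.mul k (TensorAlgebra k g) ∘ₗ dynkin) ∘ₗ
            LinearMap.mulLeft k (primMap k g (TensorAlgebra.ι k v)) =
          LinearMap.mulLeft k (TensorAlgebra.ι k v) ∘ₗ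
            (augLeft + gradedLift (LinearMap.mul k (TensorAlgebra k g) ∘ₗ dynkin)) := by
        refine gradedTensor_ext fun i a ha b => ?_
        simp only [LinearMap.comp_apply, LinearMap.mulLeft_apply, LinearMap.add_apply, one_mul,
          primMap_mul_tmul (ι_mem_grading v) ha, map_add, map_smul, augLeft_tmul, gradedLift_tmul,
          LinearMap.mul_apply', dynkin_ι_mul, sgn_of_mem (dynkin_mem_grading ha), sub_mul,
          smul_mul_assoc, mul_assoc]
        abel
      have := LinearMap.congr_fun this t
      simp only [LinearMap.comp_apply, LinearMap.mulLeft_apply, LinearMap.add_apply, mul_add] at this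
      exact this
  exact LinearMap.congr_fun this w

theorem deriv_id_of_mem {n : ℕ} {w : TensorAlgebra k g} (hw : w ∈ grading k g n) :
    deriv LinearMap.id w = (n : k) • w := by
  rw [grading_eq_span] at hw
  induction hw using Submodule.span_induction with
  | mem w h =>
    obtain ⟨x, rfl⟩ := h
    rw [deriv_tprod]
    simp only [LinearMap.id_apply, Function.update_eq_self, Finset.sum_const, Finset.card_univ,
      Fintype.card_fin, Nat.cast_smul_eq_nsmul]
  | zero => simp
  | add a b _ _ ha hb => rw [map_add, ha, hb, smul_add]
  | smul c a _ ha => rw [map_smul, ha, smul_comm]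

theorem decompose_deriv_id (w : TensorAlgebra k g) (i : ℕ) :
    (DirectSum.decompose (grading k g) (deriv LinearMap.id w) i : TensorAlgebra k g) =
      (i : k) • (DirectSum.decompose (grading k g) w i : TensorAlgebra k g) := by
  induction w using DirectSum.Decomposition.inductionOn (grading k g) with
  | zero => simp
  | @homogeneous j m =>
    obtain ⟨m, hm⟩ := m
    rw [deriv_id_of_mem hm, DirectSum.decompose_smul]
    by_cases h : j = i
    · subst h; rfl
    · rw [DirectSum.decompose_of_mem_ne _ hm h, DirectSum.smul_apply, Submodule.coe_smul,
        DirectSum.decompose_of_mem_ne _ hm h, smul_zero, smul_zero]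
  | add a b ha hb => simp only [map_add, DirectSum.decompose_add, DirectSum.add_apply,
      Submodule.coe_add, smul_add, ha, hb]

/-- For primitive X the convolution formula reduces to: Dynkin of X equals X with each component
multiplied by its degree. Components of positive degree i are thus in Lie(sg) after division by i,
and the component of degree 0 vanishes by the counit. -/
theorem primitives_le_lie [CharZero k] : primitives k g ≤ lie k g := by
  classical
  intro X hX
  have hN := dynkin_convolution X
  rw [mem_primitives.1 hX, primMap_apply, map_add, gradedLift_tmul, gradedLift_tmul] at hN
  simp only [LinearMap.comp_apply, LinearMap.mul_apply', dynkin_one, mul_one, zero_mul,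
    add_zero] at hN
  rw [← DirectSum.sum_support_decompose (grading k g) X]
  refine Submodule.sum_mem _ fun i _ => ?_
  rcases Nat.eq_zero_or_pos i with rfl | hi
  · rw [decompose_zero_eq, aug_of_mem_primitives hX, map_zero]
    exact Submodule.zero_mem _
  · have h := lie_isHomogeneous k g i (dynkin_mem_lie X)
    rw [hN, decompose_deriv_id] at h
    exact (Submodule.smul_mem_iff _ (Nat.cast_ne_zero.2 hi.ne')).1 h

theorem lie_eq_primitives [CharZero k] : lie k g = primitives k g :=
  le_antisymm lie_le_primitives primitives_le_lie

end Dynkin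

end LeibnizComplex

/-! ### Koszul signs and the universal property of graded symmetric powers -/

namespace GradedSym

variable {k : Type*} [Field k] {W : Type*} [AddCommGroup W] [Module k W]

/-- τ is σ on the later positions, with values renumbered so as to skip σ 0. -/
theorem exists_perm_succAbove {n : ℕ} (σ : Equiv.Perm (Fin (n + 1))) :
    ∃ τ : Equiv.Perm (Fin n), ∀ l, σ l.succ = (σ 0).succAbove (τ l) := by
  refine ⟨((finSuccAboveEquiv 0).trans (σ.subtypeEquiv (q := fun x => x ≠ σ 0)
    fun a => by simp)).trans (finSuccAboveEquiv (σ 0)).symm, fun l => ?_⟩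
  have h := (finSuccAboveEquiv (σ 0)).apply_symm_apply
    (σ.subtypeEquiv (q := fun x => x ≠ σ 0) (fun a => by simp) (finSuccAboveEquiv 0 l))
  have h2 := congrArg Subtype.val h
  rw [finSuccAboveEquiv_apply] at h2
  exact h2.symm

/-- Inversions involving position 0 give the sign of moving the factor σ 0 to the front; the others
are the inversions of τ. This permits induction on n without decomposing σ into transpositions. -/
theorem koszulSign_succ {n : ℕ} (σ : Equiv.Perm (Fin (n + 1))) (τ : Equiv.Perm (Fin n))
    (h : ∀ l, σ l.succ = (σ 0).succAbove (τ l)) (p : Fin (n + 1) → ℕ) :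
    (koszulSign σ p : k) =
      (∏ j, if (σ 0).succAbove j < σ 0 then (-1 : k) ^ (p (σ 0) * p ((σ 0).succAbove j)) else 1) *
        koszulSign τ (p ∘ (σ 0).succAbove) := by
  rw [koszulSign, Fin.prod_univ_succ]
  congr 1
  · rw [Fin.prod_univ_succ]
    refine Eq.trans ?_ (Equiv.prod_comp τ _)
    simp [h]
  · refine Finset.prod_congr rfl fun a _ => ?_
    rw [Fin.prod_univ_succ]
    simp [h]

/-- Tensor powers of a graded module are spanned by the tensors of homogeneous elements. -/
theorem tprod_mem_span_homogeneous (𝒲 : ℕ → Submodule k W) [DirectSum.Decomposition 𝒲] {n : ℕ}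
    (w : Fin n → W) :
    PiTensorProduct.tprod k w ∈ Submodule.span k {t | ∃ (p : Fin n → ℕ) (w : Fin n → W),
      (∀ i, w i ∈ 𝒲 (p i)) ∧ t = PiTensorProduct.tprod k w} := by
  classical
  have : w = fun i => ∑ m ∈ (DirectSum.decompose 𝒲 (w i)).support,
      (DirectSum.decompose 𝒲 (w i) m : W) :=
    funext fun i => (DirectSum.sum_support_decompose 𝒲 (w i)).symm
  rw [this, MultilinearMap.map_sum_finset]
  exact Submodule.sum_mem _ fun r _ => Submodule.subset_span
    ⟨r, _, fun i => (DirectSum.decompose 𝒲 (w i) (r i)).2, rfl⟩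

theorem span_homogeneous_eq_top (𝒲 : ℕ → Submodule k W) [DirectSum.Decomposition 𝒲] (n : ℕ) :
    Submodule.span k {t | ∃ (p : Fin n → ℕ) (w : Fin n → W),
      (∀ i, w i ∈ 𝒲 (p i)) ∧ t = symProd 𝒲 w} = ⊤ := by
  rw [eq_top_iff, ← Submodule.range_mkQ (symRel 𝒲 n), LinearMap.range_eq_map,
    ← PiTensorProduct.span_tprod_eq_top, Submodule.map_span, Submodule.span_le]
  rintro _ ⟨_, ⟨w, rfl⟩, rfl⟩
  have h := Submodule.mem_map_of_mem (f := (symRel 𝒲 n).mkQ) (tprod_mem_span_homogeneous 𝒲 w)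
  rw [Submodule.map_span] at h
  refine Submodule.span_mono ?_ h
  rintro _ ⟨_, ⟨p, w, hw, rfl⟩, rfl⟩
  exact ⟨p, w, hw, rfl⟩

theorem symPow_ext (𝒲 : ℕ → Submodule k W) [DirectSum.Decomposition 𝒲] {n : ℕ}
    {U : Type*} [AddCommGroup U] [Module k U] {f h : SymPow 𝒲 n →ₗ[k] U}
    (H : ∀ (p : Fin n → ℕ) (w : Fin n → W), (∀ i, w i ∈ 𝒲 (p i)) →
      f (symProd 𝒲 w) = h (symProd 𝒲 w)) : f = h := by
  refine LinearMap.ext_on (span_homogeneous_eq_top 𝒲 n) ?_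
  rintro _ ⟨p, w, hw, rfl⟩
  exact H p w hw

theorem symD_symProd (𝒲 : ℕ → Submodule k W) [DirectSum.Decomposition 𝒲] (d : W →ₗ[k] W)
    (hd : HasDegNegOne 𝒲 d) {n : ℕ} (p : Fin n → ℕ) (w : Fin n → W) (hw : ∀ i, w i ∈ 𝒲 (p i)) :
    symD 𝒲 d hd n (symProd 𝒲 w) =
      ∑ i : Fin n, (∏ j : Fin n, if j < i then (-1 : k) ^ p j else 1) •
        symProd 𝒲 (Function.update w i (d (w i))) := by
  simp only [symD, symProd, Submodule.mkQ_apply, Submodule.mapQ_apply]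
  rw [tensorD_tprod 𝒲 d p w hw]
  simp only [← Submodule.mkQ_apply, map_sum, map_smul]

theorem symMap_symProd {W' : Type*} [AddCommGroup W'] [Module k W'] (𝒲 : ℕ → Submodule k W)
    (𝒲' : ℕ → Submodule k W') (f : W →ₗ[k] W') (hf : ∀ m, ∀ w ∈ 𝒲 m, f w ∈ 𝒲' m) {n : ℕ}
    (w : Fin n → W) :
    symMap 𝒲 𝒲' f hf n (symProd 𝒲 w) = symProd 𝒲' fun i => f (w i) :=
  congrArg (symRel 𝒲' n).mkQ (PiTensorProduct.map_tprod (fun _ => f) w)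

/-- The linear map on `Sⁿ(W)` given by a graded symmetric multilinear map. -/
noncomputable def symLift (𝒲 : ℕ → Submodule k W) {n : ℕ} {U : Type*} [AddCommGroup U] [Module k U]
    (f : MultilinearMap k (fun _ : Fin n => W) U)
    (hf : ∀ (σ : Equiv.Perm (Fin n)) (p : Fin n → ℕ) (w : Fin n → W), (∀ i, w i ∈ 𝒲 (p i)) →
      f w = (koszulSign σ p : k) • f (w ∘ σ)) : SymPow 𝒲 n →ₗ[k] U :=
  (symRel 𝒲 n).liftQ (PiTensorProduct.lift f) <| by
    refine Submodule.span_le.2 ?_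
    rintro _ ⟨σ, p, w, hw, rfl⟩
    rw [SetLike.mem_coe, LinearMap.mem_ker, map_sub, map_smul, PiTensorProduct.lift.tprod,
      PiTensorProduct.lift.tprod, sub_eq_zero]
    exact hf σ p w hw

theorem symLift_symProd (𝒲 : ℕ → Submodule k W) {n : ℕ} {U : Type*} [AddCommGroup U] [Module k U]
    (f : MultilinearMap k (fun _ : Fin n => W) U) (hf) (w : Fin n → W) :
    symLift 𝒲 f hf (symProd 𝒲 w) = f w :=
  PiTensorProduct.lift.tprod _

end GradedSym

namespace LeibnizComplex

/-! ### Products of Lie elements modulo lower filtration -/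

section Product

variable {k : Type*} [Field k] {g : Type*} [AddCommGroup g] [Module k g]

variable (k g) in
/-- The product `X₀ ⋯ Xₙ₋₁` in `T(s g)` of elements of `Lie(s g)`. -/
noncomputable def lieProd (n : ℕ) :
    MultilinearMap k (fun _ : Fin n => lie k g) (TensorAlgebra k g) :=
  (MultilinearMap.mkPiAlgebraFin k n (TensorAlgebra k g)).compLinearMap fun _ => (lie k g).subtype

theorem lieProd_apply {n : ℕ} (X : Fin n → lie k g) :
    lieProd k g n X = (List.ofFn fun i => (X i : TensorAlgebra k g)).prod := by
  simp [lieProd]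

theorem lieProd_zero (X : Fin 0 → lie k g) : lieProd k g 0 X = 1 := by simp [lieProd_apply]

theorem lieProd_succ {n : ℕ} (X : Fin (n + 1) → lie k g) :
    lieProd k g (n + 1) X = X 0 * lieProd k g n (fun i => X i.succ) := by
  simp only [lieProd_apply, List.ofFn_succ, List.prod_cons]

theorem lieProd_succ' {n : ℕ} (X : Fin (n + 1) → lie k g) :
    lieProd k g (n + 1) X = lieProd k g n (fun i => X i.castSucc) * X (Fin.last n) := by
  simp only [lieProd_apply, List.ofFn_succ', List.prod_concat]

theorem lieProd_mem_fil {n : ℕ} (X : Fin n → lie k g) : lieProd k g n X ∈ fil k g n := by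
  induction n with
  | zero => rw [lieProd_zero]; exact one_mem_fil 0
  | succ n ih => rw [lieProd_succ]; exact lie_mul_mem_fil (X 0).2 (ih _)

theorem lieProd_mem_grading {n : ℕ} {p : Fin n → ℕ} {X : Fin n → lie k g}
    (hX : ∀ i, X i ∈ lieGrading k g (p i)) : lieProd k g n X ∈ grading k g (∑ i, p i) := by
  induction n with
  | zero => rw [lieProd_zero]; exact one_mem_grading
  | succ n ih =>
    rw [lieProd_succ, Fin.sum_univ_succ]
    exact mul_mem_grading (hX 0) (ih fun i => hX i.succ)

/-- Each factor that X i passes costs a commutator, which lies in Lie(sg) and replaces two factors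
by one, so the error is a product of n Lie elements. -/
theorem lieProd_sub_front_mem {n : ℕ} {p : Fin (n + 1) → ℕ} {X : Fin (n + 1) → lie k g}
    (hX : ∀ i, X i ∈ lieGrading k g (p i)) (i : Fin (n + 1)) :
    lieProd k g (n + 1) X -
      (∏ j, if i.succAbove j < i then (-1 : k) ^ (p i * p (i.succAbove j)) else 1) •
        (X i * lieProd k g n (X ∘ i.succAbove)) ∈ fil k g n := by
  induction n with
  | zero =>
    obtain rfl := Subsingleton.elim (α := Fin 1) i 0
    simp [lieProd_succ, lieProd_zero]
  | succ n ih =>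
    induction i using Fin.cases with
    | zero => simp [lieProd_succ X, Function.comp_def]
    | succ i =>
      -- By induction the chosen factor is moved up to second place (`h1`); the commutator with X 0
      -- then accounts for the last exchange (`h2`).
      have h1 := lie_mul_mem_fil (X 0).2 (ih (fun j => hX j.succ) i)
      have h2 := mul_mem_fil (mem_fil_one (lie_bracket_mem (X 0).2 (hX 0) (X i.succ).2 (hX i.succ)))
        (lieProd_mem_fil fun j => X (i.succAbove j).succ)
      rw [add_comm] at h2
      have h3 := Submodule.add_mem _ h1 (Submodule.smul_mem _
        (∏ j, if i.succAbove j < i then (-1 : k) ^ (p i.succ * p (i.succAbove j).succ) else 1) h2)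
      convert! h3 using 1
      rw [lieProd_succ X, lieProd_succ (X ∘ i.succ.succAbove), Fin.prod_univ_succ]
      simp only [Fin.succ_succAbove_zero, Fin.succ_pos, if_true, Fin.succ_succAbove_succ,
        Fin.succ_lt_succ_iff, Function.comp_def, mul_comm (p i.succ) (p 0), mul_sub, sub_mul,
        smul_sub, mul_smul, mul_smul_comm, smul_mul_assoc, mul_assoc]
      rw [smul_comm]
      abel

/-- The product of homogeneous elements of `Lie(s g)` is graded commutative modulo the next smaller
piece of the filtration. -/
theorem lieProd_sub_perm_mem {n : ℕ} {p : Fin n → ℕ} {X : Fin n → lie k g}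
    (hX : ∀ i, X i ∈ lieGrading k g (p i)) (σ : Equiv.Perm (Fin n)) :
    lieProd k g n X - (GradedSym.koszulSign σ p : k) • lieProd k g n (X ∘ σ) ∈ filPred k g n := by
  induction n with
  | zero => simp [lieProd_zero, GradedSym.koszulSign]
  | succ n ih =>
    obtain ⟨τ, hτ⟩ := GradedSym.exists_perm_succAbove σ
    rw [GradedSym.koszulSign_succ σ τ hτ]
    have h1 := lieProd_sub_front_mem hX (σ 0)
    have h2 := lie_mul_mem_fil_of_filPred (X (σ 0)).2 (ih (fun j => hX ((σ 0).succAbove j)) τ)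
    convert! Submodule.add_mem _ h1 (Submodule.smul_mem _ (∏ j, if (σ 0).succAbove j < σ 0 then
      (-1 : k) ^ (p (σ 0) * p ((σ 0).succAbove j)) else 1) h2) using 1
    rw [lieProd_succ (X ∘ σ)]
    simp only [Function.comp_def, hτ, mul_sub, smul_sub, mul_smul, mul_smul_comm]
    abel

/-- This is the source of surjectivity, with homogeneous factors so that degrees can be followed. -/
theorem fil_le_sup_span (n : ℕ) :
    fil k g n ≤ filPred k g n ⊔ Submodule.span k {x | ∃ (p : Fin n → ℕ) (X : Fin n → lie k g),
      (∀ i, X i ∈ lieGrading k g (p i)) ∧ x = lieProd k g n X} := by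
  induction n with
  | zero =>
    rw [fil_zero, Submodule.one_eq_span]
    refine le_sup_of_le_right (Submodule.span_mono ?_)
    rintro _ rfl
    exact ⟨Fin.elim0, Fin.elim0, fun i => i.elim0, (lieProd_zero _).symm⟩
  | succ n ih =>
    conv_lhs => rw [fil_succ']
    refine sup_le le_sup_left ((mul_le_mul' (le_span_homogeneous (lie_isHomogeneous k g))
      ih).trans ?_)
    rw [Submodule.mul_sup]
    refine sup_le (le_sup_of_le_left ?_) (le_sup_of_le_right ?_)
    · rw [Submodule.mul_le]
      intro X hX w hw
      refine lie_mul_mem_fil_of_filPred ?_ hw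
      exact (Submodule.span_le.2 fun x hx => hx.1) hX
    · rw [Submodule.span_mul_span]
      refine Submodule.span_mono ?_
      rintro _ ⟨Y, ⟨hY, q, hq⟩, _, ⟨p, X, hX, rfl⟩, rfl⟩
      refine ⟨Fin.cons q p, Fin.cons ⟨Y, hY⟩ X, fun i => ?_, ?_⟩
      · induction i using Fin.cases with
        | zero => exact hq
        | succ i => exact hX i
      · simp [lieProd_succ]

/-- Splitting off the last factor, `leibD_mul_of_mem_lie` is the graded Leibniz rule up to D_x
applied to a product of one factor fewer, which lies in the lower piece. -/
theorem leibD_lieProd_sub_mem (L : LeibnizAlgebra k g) {n : ℕ} {p : Fin n → ℕ}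
    {X : Fin n → lie k g} (hX : ∀ i, X i ∈ lieGrading k g (p i)) :
    leibD L (lieProd k g n X) - ∑ i : Fin n, (∏ j : Fin n, if j < i then (-1 : k) ^ p j else 1) •
      lieProd k g n (Function.update X i (lieD L (lie_isSubcomplex L) (X i))) ∈
        filPred k g n := by
  induction n with
  | zero => simp [lieProd_zero]
  | succ n ih =>
    obtain ⟨Y, y, rfl⟩ : ∃ Y y, X = Fin.snoc Y y := ⟨_, _, (Fin.snoc_init_self X).symm⟩
    obtain ⟨q, r, rfl⟩ : ∃ q r, p = Fin.snoc q r := ⟨_, _, (Fin.snoc_init_self p).symm⟩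
    have hY : ∀ i, Y i ∈ lieGrading k g (q i) := fun i => by simpa using hX i.castSucc
    obtain ⟨x, hx⟩ := leibD_mul_of_mem_lie L y.2
    have h1 := mul_lie_mem_fil_of_filPred y.2 (ih hY)
    have h2 : deriv (L.mul.flip x) (sgn k g (lieProd k g n Y)) ∈ fil k g n :=
      deriv_mem_fil _ (sgn_mem (fil_isHomogeneous k g n) (lieProd_mem_fil Y))
    convert! Submodule.add_mem _ h1 h2 using 1
    have hsgn : (∏ j : Fin n, (-1 : k) ^ q j) = (-1) ^ ∑ j, q j :=
      Finset.prod_pow_eq_pow_sum _ _ _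
    rw [lieProd_succ']
    simp only [Fin.snoc_castSucc, Fin.snoc_last, hx]
    rw [sgn_of_mem (lieProd_mem_grading hY), Fin.sum_univ_castSucc]
    simp only [Fin.prod_univ_castSucc, Fin.castSucc_lt_castSucc_iff, Fin.snoc_castSucc,
      Fin.castSucc_lt_last, if_true, Fin.snoc_last, lt_irrefl, if_false, mul_one, hsgn,
      (Fin.le_last _).not_gt, ← Fin.snoc_update, Fin.update_snoc_last, lieProd_succ', sub_mul,
      Finset.sum_mul, smul_mul_assoc]
    simp only [lieD, LinearMap.coe_restrict_apply]
    abel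

end Product

/-! ### The comparison map: degrees, surjectivity, differentials, naturality -/

section SymToGr

variable (k : Type*) [Field k] (g : Type*) [AddCommGroup g] [Module k g]

/-- The class of the product of `n` elements of `Lie(s g)` in `fil n / fil (n - 1)`. -/
noncomputable def grProd (n : ℕ) : MultilinearMap k (fun _ : Fin n => lie k g) (Gr k g n) :=
  ((filPred k g n).submoduleOf (fil k g n)).mkQ.compMultilinearMap
    ((lieProd k g n).codRestrict (fil k g n) lieProd_mem_fil)

variable {k g}

theorem grProd_apply {n : ℕ} (X : Fin n → lie k g) :
    grProd k g n X = Submodule.Quotient.mk ⟨lieProd k g n X, lieProd_mem_fil X⟩ := rfl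

theorem grProd_perm {n : ℕ} (σ : Equiv.Perm (Fin n)) (p : Fin n → ℕ) (X : Fin n → lie k g)
    (hX : ∀ i, X i ∈ lieGrading k g (p i)) :
    grProd k g n X = (GradedSym.koszulSign σ p : k) • grProd k g n (X ∘ σ) := by
  rw [grProd_apply, grProd_apply, ← Submodule.Quotient.mk_smul, Submodule.Quotient.eq]
  exact lieProd_sub_perm_mem hX σ

variable (k g) in
/-- The map `Sⁿ(Lie(s g)) → fil n / fil (n - 1)` that is induced by the product of `T(s g)`. -/
noncomputable def symToGr (n : ℕ) : SymLie k g n →ₗ[k] Gr k g n :=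
  GradedSym.symLift (lieGrading k g) (grProd k g n) grProd_perm

theorem symToGr_symProd {n : ℕ} (X : Fin n → lie k g) :
    symToGr k g n (GradedSym.symProd (lieGrading k g) X) =
      Submodule.Quotient.mk ⟨lieProd k g n X, lieProd_mem_fil X⟩ :=
  GradedSym.symLift_symProd _ _ _ X

theorem symDeg_map_le (n m : ℕ) :
    (GradedSym.symDeg (lieGrading k g) n m).map (symToGr k g n) ≤ grDeg k g n m := by
  rw [GradedSym.symDeg, Submodule.map_span, Submodule.span_le]
  rintro _ ⟨_, ⟨p, X, hX, rfl, rfl⟩, rfl⟩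
  rw [symToGr_symProd]
  exact ⟨⟨_, lieProd_mem_fil X⟩, lieProd_mem_grading hX, rfl⟩

/-- A product of homogeneous factors is its own component in the total degree and has no other. The
statement gives both surjectivity and the equality of the degree m parts. -/
theorem mk_decompose_mem_map_symDeg (n m : ℕ) {x : TensorAlgebra k g} (hx : x ∈ fil k g n) :
    (Submodule.Quotient.mk ⟨_, fil_isHomogeneous k g n m hx⟩ : Gr k g n) ∈
      (GradedSym.symDeg (lieGrading k g) n m).map (symToGr k g n) := by
  obtain ⟨y, hy, z, hz, rfl⟩ := Submodule.mem_sup.1 (fil_le_sup_span n hx)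
  have key : ∀ z ∈ Submodule.span k {x | ∃ (p : Fin n → ℕ) (X : Fin n → lie k g),
      (∀ i, X i ∈ lieGrading k g (p i)) ∧ x = lieProd k g n X},
      ∃ h : (DirectSum.decompose (grading k g) z m : TensorAlgebra k g) ∈ fil k g n,
        (Submodule.Quotient.mk ⟨_, h⟩ : Gr k g n) ∈
          (GradedSym.symDeg (lieGrading k g) n m).map (symToGr k g n) := by
    intro z hz
    induction hz using Submodule.span_induction with
    | mem z hz =>
      obtain ⟨p, X, hX, rfl⟩ := hz
      have hm := lieProd_mem_grading hX
      refine ⟨fil_isHomogeneous k g n m (lieProd_mem_fil X), ?_⟩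
      by_cases h : ∑ i, p i = m
      · refine ⟨_, Submodule.subset_span ⟨p, X, hX, h, rfl⟩, ?_⟩
        rw [symToGr_symProd]
        congr 2
        rw [← h, DirectSum.decompose_of_mem_same _ hm]
      · convert! Submodule.zero_mem _
        rw [Submodule.Quotient.mk_eq_zero]
        have := DirectSum.decompose_of_mem_ne _ hm h
        simp only [this]
        exact Submodule.zero_mem _
    | zero =>
      refine ⟨by simp, ?_⟩
      convert! Submodule.zero_mem _
      rw [Submodule.Quotient.mk_eq_zero]
      simp only [DirectSum.decompose_zero, DirectSum.zero_apply, Submodule.coe_zero]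
      exact Submodule.zero_mem _
    | add a b _ _ ha hb =>
      obtain ⟨ha, ha'⟩ := ha
      obtain ⟨hb, hb'⟩ := hb
      refine ⟨by rw [DirectSum.decompose_add]; exact Submodule.add_mem _ ha hb, ?_⟩
      convert! Submodule.add_mem _ ha' hb' using 1
      rw [← Submodule.Quotient.mk_add]
      congr 2
      rw [DirectSum.decompose_add]; rfl
    | smul c a _ ha =>
      obtain ⟨ha, ha'⟩ := ha
      refine ⟨by rw [DirectSum.decompose_smul]; exact Submodule.smul_mem _ c ha, ?_⟩
      convert! Submodule.smul_mem _ c ha' using 1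
      rw [← Submodule.Quotient.mk_smul]
      congr 2
      rw [DirectSum.decompose_smul]; rfl
  obtain ⟨h, h'⟩ := key z hz
  -- The summand y lies in the lower piece, which is homogeneous, so the component of y disappears
  -- in the quotient.
  convert! h' using 1
  rw [Submodule.Quotient.eq]
  change (DirectSum.decompose (grading k g) (y + z) m : TensorAlgebra k g) -
    DirectSum.decompose (grading k g) z m ∈ filPred k g n
  rw [DirectSum.decompose_add, DirectSum.add_apply, Submodule.coe_add, add_sub_cancel_right]
  exact filPred_isHomogeneous n m hy

theorem symDeg_map (n m : ℕ) :
    (GradedSym.symDeg (lieGrading k g) n m).map (symToGr k g n) = grDeg k g n m := by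
  refine le_antisymm (symDeg_map_le n m) ?_
  rintro _ ⟨⟨x, hx⟩, hm, rfl⟩
  have h := mk_decompose_mem_map_symDeg n m hx
  simp only [DirectSum.decompose_of_mem_same _ (show x ∈ grading k g m from hm)] at h
  exact h

theorem symToGr_surjective (n : ℕ) : Function.Surjective (symToGr k g n) := by
  rw [← LinearMap.range_eq_top, eq_top_iff]
  intro t _
  obtain ⟨⟨x, hx⟩, rfl⟩ := Submodule.Quotient.mk_surjective _ t
  classical
  have hsum : (⟨x, hx⟩ : fil k g n) = ∑ i ∈ (DirectSum.decompose (grading k g) x).support,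
      ⟨(DirectSum.decompose (grading k g) x i : TensorAlgebra k g),
        fil_isHomogeneous k g n i hx⟩ := by
    apply Subtype.ext
    simpa using (DirectSum.sum_support_decompose (grading k g) x).symm
  rw [hsum, ← Submodule.mkQ_apply, map_sum]
  exact Submodule.sum_mem _ fun i _ =>
    LinearMap.map_le_range (mk_decompose_mem_map_symDeg n i hx)

theorem grD_comp_symToGr (L : LeibnizAlgebra k g) (n : ℕ) :
    grD L (fil_isSubcomplex L) n ∘ₗ symToGr k g n =
      symToGr k g n ∘ₗ symLieD L (lie_isSubcomplex L) n := by
  refine GradedSym.symPow_ext _ fun p X hX => ?_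
  rw [LinearMap.comp_apply, LinearMap.comp_apply, symLieD,
    GradedSym.symD_symProd _ _ _ p X hX, map_sum, symToGr_symProd]
  simp only [map_smul, symToGr_symProd, ← Submodule.mkQ_apply]
  simp only [← map_smul, ← map_sum]
  change Submodule.Quotient.mk _ = Submodule.Quotient.mk _
  rw [Submodule.Quotient.eq]
  have h := leibD_lieProd_sub_mem L hX
  change (_ : TensorAlgebra k g) ∈ filPred k g n
  simpa using h

theorem grMap_comp_symToGr {h : Type*} [AddCommGroup h] [Module k h] (f : g →ₗ[k] h) (n : ℕ) :
    grMap f n ∘ₗ symToGr k g n = symToGr k h n ∘ₗ symLieMap f n := by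
  refine GradedSym.symPow_ext _ fun p X hX => ?_
  have e : symLieMap f n (GradedSym.symProd (lieGrading k g) X) =
      GradedSym.symProd (lieGrading k h) fun i => lieMap f (X i) := by
    exact GradedSym.symMap_symProd _ _ (lieMap f) (fun m w hw => tmap_mem_grading f m w hw) X
  rw [LinearMap.comp_apply, LinearMap.comp_apply, e, symToGr_symProd, symToGr_symProd]
  change Submodule.Quotient.mk _ = _
  congr 1
  refine Subtype.ext ?_
  change tmap f (lieProd k g n X) = lieProd k h n fun i => lieMap f (X i)
  rw [lieProd_apply, lieProd_apply, map_list_prod, List.map_ofFn]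
  rfl

end SymToGr

end LeibnizComplex

/-! ### Multiplication by one factor on graded symmetric powers -/

namespace GradedSym

variable {k : Type*} [Field k] {W : Type*} [AddCommGroup W] [Module k W]

theorem symProd_perm (𝒲 : ℕ → Submodule k W) {n : ℕ} (σ : Equiv.Perm (Fin n)) (p : Fin n → ℕ)
    (w : Fin n → W) (hw : ∀ i, w i ∈ 𝒲 (p i)) :
    symProd 𝒲 w = (koszulSign σ p : k) • symProd 𝒲 (w ∘ σ) := by
  rw [symProd, symProd, ← map_smul, Submodule.mkQ_apply, Submodule.mkQ_apply,
    Submodule.Quotient.eq]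
  exact Submodule.subset_span ⟨σ, p, w, hw, rfl⟩

theorem koszulSign_one {n : ℕ} (p : Fin n → ℕ) : (koszulSign 1 p : k) = 1 := by
  refine Finset.prod_eq_one fun a _ => Finset.prod_eq_one fun b _ => if_neg ?_
  rintro ⟨h1, h2⟩
  exact lt_asymm h1 h2

/-- The permutation fixes 0 and acts as σ on the rest, so position 0 takes part in no inversion. -/
theorem koszulSign_cons {n : ℕ} (σ : Equiv.Perm (Fin n)) (q : ℕ) (p : Fin n → ℕ) :
    (koszulSign (Equiv.Perm.decomposeFin.symm (0, σ)) (Fin.cons q p : Fin (n + 1) → ℕ) : k) =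
      koszulSign σ p := by
  rw [koszulSign_succ _ σ (fun l => by simp)]
  simp [Function.comp_def]

theorem koszulSign_swap {n : ℕ} (p : Fin (n + 2) → ℕ) :
    (koszulSign (Equiv.swap 0 1) p : k) = (-1) ^ (p 0 * p 1) := by
  rw [koszulSign_succ _ 1 (fun l => ?_), koszulSign_one, Fin.prod_univ_succ]
  · simp [mul_comm]
  · induction l using Fin.cases with
    | zero => simp
    | succ l =>
      have h : Equiv.swap (0 : Fin (n + 2)) 1 l.succ.succ = l.succ.succ :=
        Equiv.swap_apply_of_ne_of_ne (Fin.succ_ne_zero _) (by simp [Fin.ext_iff])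
      rw [h]
      simp

variable (𝒲 : ℕ → Submodule k W) [DirectSum.Decomposition 𝒲]

/-- The class of a tensor in `Sⁿ(W)`, as a multilinear map. -/
def symProdMultilinear (n : ℕ) : MultilinearMap k (fun _ : Fin n => W) (SymPow 𝒲 n) :=
  (symRel 𝒲 n).mkQ.compMultilinearMap (PiTensorProduct.tprod k)

/-- This makes multiplication by x well defined on coinvariants. Both sides are linear in x, so x
may be taken homogeneous, and the permutation extended by fixing 0. -/
theorem symProd_cons_perm {n : ℕ} (x : W) (σ : Equiv.Perm (Fin n)) (p : Fin n → ℕ)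
    (w : Fin n → W) (hw : ∀ i, w i ∈ 𝒲 (p i)) :
    (symProdMultilinear 𝒲 (n + 1)).curryLeft x w =
      (koszulSign σ p : k) • (symProdMultilinear 𝒲 (n + 1)).curryLeft x (w ∘ σ) := by
  induction x using DirectSum.Decomposition.inductionOn 𝒲 with
  | zero => simp
  | @homogeneous q x =>
    have h := symProd_perm 𝒲 (Equiv.Perm.decomposeFin.symm (0, σ)) (Fin.cons q p)
      (Fin.cons (x : W) w) (fun i => by
        induction i using Fin.cases with
        | zero => exact x.2
        | succ i => exact hw i)
    rw [koszulSign_cons] at h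
    refine h.trans ?_
    congr 1
    change symProd 𝒲 _ = symProd 𝒲 _
    congr 1
    funext i
    induction i using Fin.cases with
    | zero => simp
    | succ i => simp
  | add a b ha hb => rw [map_add, add_apply, add_apply, ha, hb,
      smul_add]

/-- The product `W ⊗ Sⁿ(W) → Sⁿ⁺¹(W)`. -/
noncomputable def symCons (n : ℕ) : W →ₗ[k] SymPow 𝒲 n →ₗ[k] SymPow 𝒲 (n + 1) where
  toFun x := symLift 𝒲 ((symProdMultilinear 𝒲 (n + 1)).curryLeft x) (symProd_cons_perm 𝒲 x)
  map_add' x y := symPow_ext 𝒲 fun p w _ => by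
    rw [LinearMap.add_apply, symLift_symProd, symLift_symProd, symLift_symProd, map_add]
    rfl
  map_smul' c x := symPow_ext 𝒲 fun p w _ => by
    rw [RingHom.id_apply, LinearMap.smul_apply, symLift_symProd, symLift_symProd, map_smul]
    rfl

theorem symCons_symProd {n : ℕ} (x : W) (w : Fin n → W) :
    symCons 𝒲 n x (symProd 𝒲 w) = symProd 𝒲 (Fin.cons x w : Fin (n + 1) → W) :=
  symLift_symProd 𝒲 _ (symProd_cons_perm 𝒲 x) w

theorem symCons_symCons {n p q : ℕ} {x y : W} (hx : x ∈ 𝒲 p) (hy : y ∈ 𝒲 q) (s : SymPow 𝒲 n) :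
    symCons 𝒲 (n + 1) x (symCons 𝒲 n y s) =
      (-1 : k) ^ (p * q) • symCons 𝒲 (n + 1) y (symCons 𝒲 n x s) := by
  have : symCons 𝒲 (n + 1) x ∘ₗ symCons 𝒲 n y =
      (-1 : k) ^ (p * q) • symCons 𝒲 (n + 1) y ∘ₗ symCons 𝒲 n x := by
    refine symPow_ext 𝒲 fun r w hw => ?_
    simp only [LinearMap.comp_apply, LinearMap.smul_apply, symCons_symProd]
    have h := symProd_perm 𝒲 (Equiv.swap 0 1) (Fin.cons p (Fin.cons q r))
      (Fin.cons x (Fin.cons y w)) (fun i => by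
        induction i using Fin.cases with
        | zero => exact hx
        | succ i =>
          induction i using Fin.cases with
          | zero => exact hy
          | succ i => exact hw i)
    rw [koszulSign_swap] at h
    refine h.trans ?_
    congr 2
    funext i
    induction i using Fin.cases with
    | zero => simp
    | succ i =>
      induction i using Fin.cases with
      | zero => simp
      | succ i =>
        have h : Equiv.swap (0 : Fin (n + 2)) 1 i.succ.succ = i.succ.succ :=
          Equiv.swap_apply_of_ne_of_ne (Fin.succ_ne_zero _) (by simp [Fin.ext_iff])
        simp [h]
  exact LinearMap.congr_fun this s

end GradedSym

namespace LeibnizComplex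

/-! ### The projection onto Lie(sg) -/

section Retraction

variable {k : Type*} [Field k] {g : Type*} [AddCommGroup g] [Module k g]

variable (k g) in
/-- A graded projection `T(s g) → Lie(s g)`: the Dynkin operator, divided by the
degree. -/
noncomputable def lieRetraction : TensorAlgebra k g →ₗ[k] lie k g :=
  (DirectSum.toModule k ℕ (lie k g) fun m =>
    (m : k)⁻¹ • (dynkin.codRestrict (lie k g) dynkin_mem_lie) ∘ₗ (grading k g m).subtype) ∘ₗ
    (DirectSum.decomposeLinearEquiv (grading k g)).toLinearMap

theorem coe_mem_grading {m : ℕ} {X : lie k g} (hX : X ∈ lieGrading k g m) :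
    (X : TensorAlgebra k g) ∈ grading k g m := hX

theorem lieRetraction_of_mem {m : ℕ} {w : TensorAlgebra k g} (hw : w ∈ grading k g m) :
    (lieRetraction k g w : TensorAlgebra k g) = (m : k)⁻¹ • dynkin w := by
  lift w to grading k g m using hw
  simp [lieRetraction]

theorem lieRetraction_mem {m : ℕ} {w : TensorAlgebra k g} (hw : w ∈ grading k g m) :
    lieRetraction k g w ∈ lieGrading k g m := by
  change (lieRetraction k g w : TensorAlgebra k g) ∈ grading k g m
  rw [lieRetraction_of_mem hw]
  exact Submodule.smul_mem _ _ (dynkin_mem_grading hw)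

theorem lieRetraction_fil_zero {w : TensorAlgebra k g} (hw : w ∈ fil k g 0) :
    lieRetraction k g w = 0 := by
  have : w ∈ grading k g 0 := by rwa [grading, pow_zero, ← fil_zero]
  apply Subtype.ext
  -- In degree 0 the scalar is the inverse of 0, which is 0 by convention.
  simp [lieRetraction_of_mem this]

/-- The Dynkin–Specht–Wever identity: Lie elements are primitive, and on a primitive the convolution
reduces to the Dynkin operator. -/
theorem dynkin_of_mem_lie {m : ℕ} {X : TensorAlgebra k g} (hX : X ∈ lie k g)
    (hm : X ∈ grading k g m) : dynkin X = (m : k) • X := by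
  have h := dynkin_convolution X
  rw [mem_primitives.1 (lie_le_primitives hX), primMap_apply, map_add, gradedLift_tmul,
    gradedLift_tmul, deriv_id_of_mem hm] at h
  simpa [dynkin_one] using h

theorem lieRetraction_of_homogeneous [CharZero k] {m : ℕ} {X : lie k g}
    (hX : X ∈ lieGrading k g m) : lieRetraction k g (X : TensorAlgebra k g) = X := by
  apply Subtype.ext
  rw [lieRetraction_of_mem (coe_mem_grading hX), dynkin_of_mem_lie X.2 hX, smul_smul]
  -- In degree 0 division is impossible, but there a Lie element is a scalar with vanishing counit,
  -- hence 0.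
  rcases Nat.eq_zero_or_pos m with rfl | hm
  · have h := eq_aug_of_mem (coe_mem_grading hX)
    rw [aug_of_mem_primitives (lie_le_primitives X.2), map_zero] at h
    rw [h, smul_zero]
  · rw [inv_mul_cancel₀ (Nat.cast_ne_zero.2 hm.ne'), one_smul]

end Retraction

/-! ### Convolution powers of the projection, and injectivity -/

section Symbol

variable {k : Type*} [Field k] {g : Type*} [AddCommGroup g] [Module k g]

theorem fil_succ_le {n : ℕ} {S : Submodule k (TensorAlgebra k g)} (h1 : fil k g n ≤ S)
    (h2 : ∀ p, ∀ X : lie k g, X ∈ lieGrading k g p → ∀ w ∈ fil k g n,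
      (X : TensorAlgebra k g) * w ∈ S) : fil k g (n + 1) ≤ S := by
  rw [fil_succ']
  refine sup_le h1 ((mul_le_mul' (le_span_homogeneous (lie_isHomogeneous k g)) le_rfl).trans ?_)
  rw [Submodule.mul_le]
  intro X hX w hw
  induction hX using Submodule.span_induction with
  | mem X hX => obtain ⟨hX, p, hp⟩ := hX; exact h2 p ⟨X, hX⟩ hp w hw
  | zero => simp
  | add x y _ _ hx hy => rw [add_mul]; exact Submodule.add_mem _ hx hy
  | smul a x _ hx => rw [smul_mul_assoc]; exact Submodule.smul_mem _ a hx

variable (k g) in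
/-- The filtration of `T(s g) ⊗ T(s g)` induced by the primitive filtration. -/
noncomputable def filTensor (n : ℕ) : Submodule k (grading k g ᵍ⊗[k] grading k g) :=
  Submodule.span k {t | ∃ i j s, i + j = n ∧ ∃ a ∈ fil k g i, a ∈ grading k g s ∧
    ∃ b ∈ fil k g j, t = a ᵍ⊗ₜ[k] b}

/-- Multiplying by a primitive X acts on one tensor factor at a time, so each term raises the total
filtration index by exactly one. -/
theorem coproduct_mem_filTensor {n : ℕ} {w : TensorAlgebra k g} (hw : w ∈ fil k g n) :
    coproduct k g w ∈ filTensor k g n := by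
  suffices fil k g n ≤ (filTensor k g n).comap (coproduct k g).toLinearMap from this hw
  clear hw w
  induction n with
  | zero =>
    rw [fil_zero, Submodule.one_eq_span, Submodule.span_le]
    rintro _ rfl
    refine Submodule.subset_span ⟨0, 0, 0, rfl, 1, one_mem_fil 0, one_mem_grading, 1,
      one_mem_fil 0, ?_⟩
    rw [AlgHom.toLinearMap_apply, map_one]
    rfl
  | succ n ih =>
    refine fil_succ_le (ih.trans (Submodule.comap_mono ?_)) fun p X hX w hw => ?_
    · refine Submodule.span_mono ?_
      rintro _ ⟨i, j, s, hij, a, ha, has, b, hb, rfl⟩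
      exact ⟨i, j + 1, s, by lia, a, ha, has, b, fil_le_succ k g j hb, rfl⟩
    · rw [Submodule.mem_comap, AlgHom.toLinearMap_apply, map_mul,
        mem_primitives.1 (lie_le_primitives X.2)]
      have hw := ih hw
      rw [Submodule.mem_comap, AlgHom.toLinearMap_apply] at hw
      generalize coproduct k g w = t at hw
      induction hw using Submodule.span_induction with
      | mem t ht =>
        obtain ⟨i, j, s, hij, a, ha, has, b, hb, rfl⟩ := ht
        rw [primMap_mul_tmul (coe_mem_grading hX) has]
        refine Submodule.add_mem _ (Submodule.subset_span ⟨i + 1, j, p + s, by lia, _,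
          lie_mul_mem_fil X.2 ha, mul_mem_grading hX has, b, hb, rfl⟩) (Submodule.smul_mem _ _
          (Submodule.subset_span ⟨i, j + 1, s, by lia, a, ha, has, _,
          lie_mul_mem_fil X.2 hb, rfl⟩))
      | zero => rw [mul_zero]; exact Submodule.zero_mem _
      | add x y _ _ hx hy => rw [mul_add]; exact Submodule.add_mem _ hx hy
      | smul a x _ hx => rw [mul_smul_comm]; exact Submodule.smul_mem _ a hx

variable (k g) in
/-- The `n`-fold convolution power of the projection `T(s g) → Lie(s g)`, with values in
`Sⁿ(Lie(s g))`. -/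
noncomputable def symbol : ∀ n : ℕ, TensorAlgebra k g →ₗ[k] SymLie k g n
  | 0 => aug.toLinearMap.smulRight (GradedSym.symProd (lieGrading k g) Fin.elim0)
  | n + 1 => gradedLift (((GradedSym.symCons (lieGrading k g) n) ∘ₗ lieRetraction k g).compl₂
      (symbol n)) ∘ₗ (coproduct k g).toLinearMap

/-- The bilinear map whose convolution is `symbol (n + 1)`. -/
noncomputable def symbolStep (n : ℕ) :
    (grading k g ᵍ⊗[k] grading k g) →ₗ[k] SymLie k g (n + 1) :=
  gradedLift (((GradedSym.symCons (lieGrading k g) n) ∘ₗ lieRetraction k g).compl₂ (symbol k g n))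

theorem symbolStep_tmul (n : ℕ) (a b : TensorAlgebra k g) :
    symbolStep n (a ᵍ⊗ₜ[k] b : grading k g ᵍ⊗[k] grading k g) =
      GradedSym.symCons (lieGrading k g) n (lieRetraction k g a) (symbol k g n b) := rfl

theorem symbol_succ (n : ℕ) (w : TensorAlgebra k g) :
    symbol k g (n + 1) w = symbolStep n (coproduct k g w) := rfl

/-- In a term a ⊗ b of total filtration n, either a is a scalar and the projection kills it, or b
has filtration below n and is killed by induction. -/
theorem symbol_eq_zero {n : ℕ} {w : TensorAlgebra k g} (hw : w ∈ filPred k g n) :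
    symbol k g n w = 0 := by
  induction n generalizing w with
  | zero => rw [(Submodule.mem_bot k).1 hw, map_zero]
  | succ n ih =>
    rw [symbol_succ]
    have h : filTensor k g n ≤ LinearMap.ker (symbolStep n) := by
      refine Submodule.span_le.2 ?_
      rintro _ ⟨i, j, s, hij, a, ha, -, b, hb, rfl⟩
      rw [SetLike.mem_coe, LinearMap.mem_ker, symbolStep_tmul]
      rcases Nat.eq_zero_or_pos i with rfl | hi
      · rw [lieRetraction_fil_zero ha, map_zero, LinearMap.zero_apply]
      · obtain ⟨m, rfl⟩ : ∃ m, n = m + 1 := ⟨n - 1, by lia⟩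
        rw [ih (fil_mono k g (by lia : j ≤ m) hb), map_zero]
    exact h (coproduct_mem_filTensor hw)

variable [CharZero k]

/-- If i > 0, then b has filtration below n and both sides vanish; if i = 0, then a is a scalar and
the projection fixes X. -/
theorem symCons_lieRetraction_mul {n i j p : ℕ} (hij : i + j = n) {X : lie k g}
    (hX : X ∈ lieGrading k g p) {a b : TensorAlgebra k g} (ha : a ∈ fil k g i)
    (hb : b ∈ fil k g j) :
    GradedSym.symCons (lieGrading k g) n (lieRetraction k g (X * a)) (symbol k g n b) =
      aug a • GradedSym.symCons (lieGrading k g) n X (symbol k g n b) := by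
  rcases Nat.eq_zero_or_pos i with rfl | hi
  · rw [fil_zero, Submodule.mem_one] at ha
    obtain ⟨c, rfl⟩ := ha
    rw [← Algebra.commutes, ← Algebra.smul_def, map_smul, lieRetraction_of_homogeneous hX]
    simp
  · obtain ⟨m, rfl⟩ : ∃ m, n = m + 1 := ⟨n - 1, by lia⟩
    have : symbol k g (m + 1) b = 0 := symbol_eq_zero (fil_mono k g (by lia : j ≤ m) hb)
    rw [this]
    simp

/-- In (X ⊗ 1 + 1 ⊗ X)Δ(w), the first summand contributes X·symbol(w) once, by the counit axiom. In
the second, induction pulls X out of the right factor with coefficient n, and graded commutativity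
moves it past the projection of the left factor; this adds n more copies. -/
theorem symbol_mul {n p : ℕ} {X : lie k g} (hX : X ∈ lieGrading k g p) {w : TensorAlgebra k g}
    (hw : w ∈ fil k g n) :
    symbol k g (n + 1) (X * w) =
      ((n + 1 : ℕ) : k) • GradedSym.symCons (lieGrading k g) n X (symbol k g n w) := by
  induction n generalizing w with
  | zero =>
    have h : filTensor k g 0 ≤ LinearMap.eqLocus
        (symbolStep 0 ∘ₗ LinearMap.mulLeft k (primMap k g X))
        (GradedSym.symCons (lieGrading k g) 0 X ∘ₗ symbol k g 0 ∘ₗ augLeft) := by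
      refine Submodule.span_le.2 ?_
      rintro _ ⟨i, j, s, hij, a, ha, has, b, hb, rfl⟩
      obtain rfl : i = 0 := by lia
      simp only [SetLike.mem_coe, LinearMap.mem_eqLocus, LinearMap.comp_apply,
        LinearMap.mulLeft_apply, primMap_mul_tmul (coe_mem_grading hX) has, map_add, map_smul, symbolStep_tmul,
        lieRetraction_fil_zero ha, LinearMap.zero_apply, map_zero, smul_zero, add_zero,
        augLeft_tmul, symCons_lieRetraction_mul hij hX ha hb]
    have h := h (coproduct_mem_filTensor hw)
    rw [symbol_succ, map_mul, mem_primitives.1 (lie_le_primitives X.2)]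
    simp only [LinearMap.mem_eqLocus, LinearMap.comp_apply, LinearMap.mulLeft_apply,
      augLeft_coproduct] at h
    rw [h]
    simp
  | succ n ih =>
    have h : filTensor k g (n + 1) ≤ LinearMap.eqLocus
        (symbolStep (n + 1) ∘ₗ LinearMap.mulLeft k (primMap k g X))
        (GradedSym.symCons (lieGrading k g) (n + 1) X ∘ₗ (symbol k g (n + 1) ∘ₗ augLeft +
          ((n + 1 : ℕ) : k) • symbolStep n)) := by
      refine Submodule.span_le.2 ?_
      rintro _ ⟨i, j, s, hij, a, ha, has, b, hb, rfl⟩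
      -- For i > 0 the right factor has filtration at most n, so induction applies, and the sign
      -- from exchanging X and the projection of a cancels the sign from the coproduct.
      have key : (-1 : k) ^ (p * s) • GradedSym.symCons (lieGrading k g) (n + 1)
          (lieRetraction k g a) (symbol k g (n + 1) (X * b)) =
          ((n + 1 : ℕ) : k) • GradedSym.symCons (lieGrading k g) (n + 1) X
            (GradedSym.symCons (lieGrading k g) n (lieRetraction k g a) (symbol k g n b)) := by
        rcases Nat.eq_zero_or_pos i with rfl | hi
        · simp [lieRetraction_fil_zero ha]
        · rw [ih (fil_mono k g (by lia : j ≤ n) hb), map_smul,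
            GradedSym.symCons_symCons _ hX (lieRetraction_mem has), smul_comm]
      simp only [SetLike.mem_coe, LinearMap.mem_eqLocus, LinearMap.comp_apply,
        LinearMap.mulLeft_apply, primMap_mul_tmul (coe_mem_grading hX) has, map_add, map_smul, symbolStep_tmul,
        LinearMap.add_apply, LinearMap.smul_apply, augLeft_tmul,
        symCons_lieRetraction_mul hij hX ha hb]
      rw [key]
    have h := h (coproduct_mem_filTensor hw)
    rw [symbol_succ, map_mul, mem_primitives.1 (lie_le_primitives X.2)]
    simp only [LinearMap.mem_eqLocus, LinearMap.comp_apply, LinearMap.mulLeft_apply,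
      LinearMap.add_apply, LinearMap.smul_apply, augLeft_coproduct, ← symbol_succ] at h
    rw [h, Nat.cast_succ (n + 1), add_smul, one_smul, map_add, map_smul]
    exact add_comm _ _

theorem symbol_lieProd {n : ℕ} {p : Fin n → ℕ} {X : Fin n → lie k g}
    (hX : ∀ i, X i ∈ lieGrading k g (p i)) :
    symbol k g n (lieProd k g n X) =
      (n.factorial : k) • GradedSym.symProd (lieGrading k g) X := by
  induction n with
  | zero =>
    rw [lieProd_zero, Subsingleton.elim X Fin.elim0]
    simp [symbol]
  | succ n ih =>
    rw [lieProd_succ, symbol_mul (hX 0) (lieProd_mem_fil _), ih fun i => hX i.succ, map_smul,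
      GradedSym.symCons_symProd, smul_smul, Nat.factorial_succ, Nat.cast_mul]
    congr 2
    exact Fin.cons_self_tail X

/-- The symbol descends to f_n/f_{n-1}, and composed with the comparison map it is multiplication by
n!, which is invertible in characteristic zero. -/
theorem symToGr_injective (n : ℕ) : Function.Injective (symToGr k g n) := by
  have h : ((filPred k g n).submoduleOf (fil k g n)).liftQ
      (symbol k g n ∘ₗ (fil k g n).subtype) (fun x hx => symbol_eq_zero hx) ∘ₗ symToGr k g n =
      (n.factorial : k) • LinearMap.id := by
    refine GradedSym.symPow_ext _ fun p X hX => ?_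
    rw [LinearMap.comp_apply, symToGr_symProd]
    exact symbol_lieProd hX
  refine (injective_iff_map_eq_zero _).2 fun s hs => ?_
  have h' := LinearMap.congr_fun h s
  rw [LinearMap.comp_apply, hs, map_zero, LinearMap.smul_apply, LinearMap.id_apply] at h'
  exact (smul_eq_zero.1 h'.symm).resolve_left (Nat.cast_ne_zero.2 n.factorial_ne_zero)

variable (k g) in
/-- The isomorphism `Sⁿ(Lie(s g)) ≃ fil n / fil (n - 1)`. -/
noncomputable def symEquivGr (n : ℕ) : SymLie k g n ≃ₗ[k] Gr k g n :=
  LinearEquiv.ofBijective (symToGr k g n) ⟨symToGr_injective n, symToGr_surjective n⟩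

end Symbol

end LeibnizComplex

theorem theorem3 {k : Type u} [Field k] [CharZero k] :
    -- `Lie(s g)` and all `fil n` are subcomplexes of the Leibniz complex
    ∃ (hLie : ∀ (g : Type v) [AddCommGroup g] [Module k g] (L : LeibnizAlgebra k g),
          LeibnizComplex.IsSubcomplex L (LeibnizComplex.lie k g))
      (hFil : ∀ (g : Type v) [AddCommGroup g] [Module k g] (L : LeibnizAlgebra k g) (n : ℕ),
          LeibnizComplex.IsSubcomplex L (LeibnizComplex.fil k g n)),
      -- `T(s g)` is a complex, `Lie(s g)` is the space of primitives of the Hopf algebra `T(s g)`,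
      -- and the filtration starts with `k`, is increasing and exhaustive
      (∀ (g : Type v) [AddCommGroup g] [Module k g] (L : LeibnizAlgebra k g),
        GradedSym.HasDegNegOne (LeibnizComplex.grading k g) (LeibnizComplex.leibD L) ∧
        LeibnizComplex.leibD L ∘ₗ LeibnizComplex.leibD L = 0 ∧
        LeibnizComplex.lie k g = LeibnizComplex.primitives k g ∧
        LeibnizComplex.fil k g 0 = Submodule.span k {1} ∧
        (∀ n : ℕ, LeibnizComplex.fil k g n ≤ LeibnizComplex.fil k g (n + 1)) ∧
        ⨆ n : ℕ, LeibnizComplex.fil k g n = ⊤) ∧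
      -- the natural isomorphisms of complexes `Sⁿ(Lie(s g), d) ≃ fil n / fil (n - 1)`
      ∃ e : ∀ (g : Type v) [AddCommGroup g] [Module k g], LeibnizAlgebra k g → ∀ n : ℕ,
          LeibnizComplex.SymLie k g n ≃ₗ[k] LeibnizComplex.Gr k g n,
        -- they preserve degrees and commute with the differentials
        (∀ (g : Type v) [AddCommGroup g] [Module k g] (L : LeibnizAlgebra k g) (n : ℕ),
          (∀ m : ℕ, (GradedSym.symDeg (LeibnizComplex.lieGrading k g) n m).map
              (e g L n).toLinearMap = LeibnizComplex.grDeg k g n m) ∧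
          LeibnizComplex.grD L (hFil g L) n ∘ₗ (e g L n).toLinearMap =
            (e g L n).toLinearMap ∘ₗ LeibnizComplex.symLieD L (hLie g L) n) ∧
        -- they are induced by the product of `T(s g)`
        (∀ (g : Type v) [AddCommGroup g] [Module k g] (L : LeibnizAlgebra k g) (n : ℕ)
          (X : Fin n → LeibnizComplex.lie k g),
          ∃ hX : (List.ofFn fun i => (X i : TensorAlgebra k g)).prod ∈ LeibnizComplex.fil k g n,
            e g L n (GradedSym.symProd (LeibnizComplex.lieGrading k g) X) =
              Submodule.Quotient.mk ⟨(List.ofFn fun i => (X i : TensorAlgebra k g)).prod, hX⟩) ∧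
        -- and they are natural for morphisms of Leibniz algebras
        (∀ (g h : Type v) [AddCommGroup g] [Module k g] [AddCommGroup h] [Module k h]
          (L : LeibnizAlgebra k g) (L' : LeibnizAlgebra k h) (f : g →ₗ[k] h),
          L.IsHom L' f → ∀ n : ℕ,
            LeibnizComplex.grMap f n ∘ₗ (e g L n).toLinearMap =
              (e h L' n).toLinearMap ∘ₗ LeibnizComplex.symLieMap f n) := by
  refine ⟨fun g _ _ L => LeibnizComplex.lie_isSubcomplex L,
    fun g _ _ L n => LeibnizComplex.fil_isSubcomplex L n, ?_, ?_⟩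
  · intro g _ _ L
    refine ⟨LeibnizComplex.leibD_hasDegNegOne L, LeibnizComplex.leibD_comp_leibD L,
      LeibnizComplex.lie_eq_primitives, ?_, LeibnizComplex.fil_le_succ k g,
      LeibnizComplex.iSup_fil k g⟩
    rw [LeibnizComplex.fil_zero, Submodule.one_eq_span]
  · refine ⟨fun g _ _ _ n => LeibnizComplex.symEquivGr k g n, ?_, ?_, ?_⟩
    · intro g _ _ L n
      exact ⟨LeibnizComplex.symDeg_map n, LeibnizComplex.grD_comp_symToGr L n⟩
    · intro g _ _ L n X
      refine ⟨LeibnizComplex.lieProd_apply X ▸ LeibnizComplex.lieProd_mem_fil X, ?_⟩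
      refine (LeibnizComplex.symToGr_symProd X).trans ?_
      congr 2
    · intro g h _ _ _ _ L L' f _ n
      exact LeibnizComplex.grMap_comp_symToGr f n
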